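/- An automaton with delay blocks (ADB) over an output alphabet $\Sigma$ has a finite set $Q$ of locations, a start location, a set of accepting locations, a finite set $D\subset\mathbb N$ of delays, and a nondeterministic transition relation whose transitions are labelled by pairs $\langle\sigma,d\rangle\in\Sigma\times D$, by $\varepsilon$, or by $\mathrm{tick}$. A run is a finite sequence of transitions from the start location to an accepting location. If its label sequence is $\alpha_0\alpha_1\dots\alpha_{n-1}$, then each label $\alpha_i=\langle\sigma,d\rangle$ outputs the symbol $\sigma$ once, at time $d+t_i$, where $t_i$ is the number of ticks among $\alpha_0,\dots,\alpha_{i-1}$. The word output by the run lists these symbols by non-decreasing output time, and symbols with equal output time appear in the order in which they were generated. The untimed language of the ADB is the set of the words over $\Sigma$ (without timestamps) output by its runs; such a language is called an untimed ADB language. **Theorem (Expressive power of ADBs).** Let $\Sigma$ be an alphabet. Every regular language over $\Sigma$ is an untimed ADB language over $\Sigma$. Moreover, whenever $a,b,c\in\Sigma$ are pairwise distinct: 1. The class of untimed ADB languages over $\Sigma$ strictly contains the class of regular languages over $\Sigma$. 2. The class of untimed ADB languages over $\Sigma$ is incomparable with the class of context-free languages over $\Sigma$: neither contains the other. More precisely: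 - the language $\{a^nb^nc^n \mid n\ge 0\}$ is an untimed ADB language and is not context-free; - the language $$\{\,a^{n_1}\,c\,a^{n_2}\,c\cdots c\,a^{n_m}\,c\,b^{n_m}\,c\,b^{n_{m-1}}\,c\cdots c\,b^{n_1} \mid m\ge 0,\ n_1,\dots,n_m\ge 1\,\}$$ (consecutive blocks are separated by one letter $c$; $m=0$ gives the empty word) is accepted by a visibly pushdown automaton, hence is context-free, and is not an untimed ADB language. -/

import Mathlib

/-- Labels of the transitions of an automaton with delay blocks over the output alphabet `α` whose
set of delays is `D`: `out s d` generates the symbol `s` through a delay block of delay `d ∈ D`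
(so `s` is to be output `d` time units later), `eps` is an `ε`-transition, and `tick` lets one unit
of time pass. -/
inductive ADBLabel (α : Type*) (D : Finset ℕ) where
  | out (s : α) (d : D)
  | eps
  | tick

/-- An automaton with delay blocks (ADB) with output alphabet `α` and locations `Q`. A delay block
is identified with its delay, a natural number; there are finitely many. Finiteness of `Q` is
required where languages of ADBs are considered. -/
structure ADB (α : Type*) (Q : Type*) where
  delays : Finset ℕ
  step : Q → ADBLabel α delays → Set Q
  start : Q
  accept : Set Q

namespace ADB

variable {α : Type*} {Q : Type*}

/-- The symbols generated by a sequence of labels, in generation order, each with its output time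
(generation time plus delay), when the current time is `t`. -/
def stamp {D : Finset ℕ} : ℕ → List (ADBLabel α D) → List (α × ℕ)
  | _, [] => []
  | t, ADBLabel.out s d :: r => (s, t + (d : ℕ)) :: stamp t r
  | t, ADBLabel.eps :: r => stamp t r
  | t, ADBLabel.tick :: r => stamp (t + 1) r

/-- The timed word output by a sequence of labels: the stamped symbols sorted by output time.
Insertion sort is stable, so symbols with the same output time keep their generation order. -/
def oword {D : Finset ℕ} (r : List (ADBLabel α D)) : List (α × ℕ) :=
  (stamp 0 r).insertionSort (fun p q => p.2 ≤ q.2)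

/-- `A.Path p r q`: from location `p` the automaton can reach `q` by transitions labelled by the
successive elements of `r`. -/
inductive Path (A : ADB α Q) : Q → List (ADBLabel α A.delays) → Q → Prop
  | nil (p : Q) : Path A p [] p
  | cons {p p' q : Q} {x : ADBLabel α A.delays} {r : List (ADBLabel α A.delays)}
      (h : p' ∈ A.step p x) (hr : Path A p' r q) : Path A p (x :: r) q

/-- The timed output language: all words output by runs from the start to an accepting location. -/
def timedLanguage (A : ADB α Q) : Set (List (α × ℕ)) :=
  {w | ∃ r : List (ADBLabel α A.delays), ∃ q ∈ A.accept, A.Path A.start r q ∧ oword r = w}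

/-- The untimed language: the timed words with the timestamps removed. -/
def untimedLanguage (A : ADB α Q) : Language α :=
  (fun w : List (α × ℕ) => w.map Prod.fst) '' A.timedLanguage

end ADB

/-- A language is an untimed ADB language if it is the untimed language of an ADB with finitely
many locations. -/
def IsUntimedADBLanguage {α : Type*} (L : Language α) : Prop :=
  ∃ (Q : Type) (_ : Finite Q) (A : ADB α Q), A.untimedLanguage = L

/-- The three kinds of letters of a visibly pushdown alphabet. -/
inductive LetterKind where
  | call
  | ret
  | internal

/-- A visibly pushdown automaton with states `Q` and stack symbols `Γ` (the bottom-of-stack symbol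
not included). The kind of the letter read determines the action on the stack: a call letter pushes
one symbol; a return letter pops the top symbol `g` (then `some g` is passed to `retStep`), or reads
the bottom-of-stack symbol without removing it (then `none` is passed); an internal letter neither
inspects nor changes the stack. -/
structure VPA (α : Type*) (Q Γ : Type*) where
  kind : α → LetterKind
  init : Set Q
  accept : Set Q
  callStep : Q → α → Set (Q × Γ)
  retStep : Q → α → Option Γ → Set Q
  intStep : Q → α → Set Q

namespace VPA

variable {α : Type*} {Q Γ : Type*}

/-- One step between configurations (a state and the stack contents, top first) reading a letter. -/
inductive Step (M : VPA α Q Γ) : Q × List Γ → α → Q × List Γ → Prop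
  | call {p q : Q} {x : α} {g : Γ} {st : List Γ} (hk : M.kind x = LetterKind.call)
      (h : (q, g) ∈ M.callStep p x) : Step M (p, st) x (q, g :: st)
  | ret {p q : Q} {x : α} {g : Γ} {st : List Γ} (hk : M.kind x = LetterKind.ret)
      (h : q ∈ M.retStep p x (some g)) : Step M (p, g :: st) x (q, st)
  | retBottom {p q : Q} {x : α} (hk : M.kind x = LetterKind.ret)
      (h : q ∈ M.retStep p x none) : Step M (p, []) x (q, [])
  | internal {p q : Q} {x : α} {st : List Γ} (hk : M.kind x = LetterKind.internal)
      (h : q ∈ M.intStep p x) : Step M (p, st) x (q, st)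

/-- `M.Reads c w c'`: reading the word `w` the automaton can go from configuration `c` to `c'`. -/
inductive Reads (M : VPA α Q Γ) : Q × List Γ → List α → Q × List Γ → Prop
  | nil (c : Q × List Γ) : Reads M c [] c
  | cons {c c' c'' : Q × List Γ} {x : α} {w : List α}
      (h : Step M c x c') (hw : Reads M c' w c'') : Reads M c (x :: w) c''

/-- The accepted language: runs start with empty stack and end in an accepting state, with any
stack. -/
def language (M : VPA α Q Γ) : Language α :=
  {w | ∃ p ∈ M.init, ∃ q ∈ M.accept, ∃ st : List Γ, M.Reads (p, []) w (q, st)}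

end VPA

/-- A language is a visibly pushdown language if it is accepted by a visibly pushdown automaton with
finitely many states and stack symbols, for some partition of the alphabet into call, return and
internal letters. -/
def IsVisiblyPushdownLanguage {α : Type*} (L : Language α) : Prop :=
  ∃ (Q : Type) (Γ : Type) (_ : Finite Q) (_ : Finite Γ) (M : VPA α Q Γ), M.language = L

/-- The language of all words `aⁿ bⁿ cⁿ` with `n ≥ 0`. -/
def tripleLanguage {α : Type*} (a b c : α) : Language α :=
  {w | ∃ n : ℕ, w = List.replicate n a ++ List.replicate n b ++ List.replicate n c}

/-- The nested language: all words obtained from `n₁, …, nₘ ≥ 1`, `m ≥ 0`, by writing the `2 m`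
blocks `a^n₁, …, a^nₘ, b^nₘ, …, b^n₁` one after the other, with the separator `h` between
consecutive blocks. -/
def nestedLanguage {α : Type*} (a b h : α) : Language α :=
  {w | ∃ ns : List ℕ, (∀ n ∈ ns, 1 ≤ n) ∧
    w = List.intercalate [h] (ns.map (fun n => List.replicate n a) ++
      ns.reverse.map (fun n => List.replicate n b))}

/-! ### Regular languages are untimed ADB languages -/

namespace ADB

variable {α : Type*} {Q : Type*}

/-! A DFA is an ADB that never ticks and has only the delay `0`: sorting then changes nothing. Still
without ticks, cycling through `a`, `b`, `c` with delays `0`, `1`, `2` makes the sort collect all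
`a`, then all `b`, then all `c`, which gives `tripleLanguage`. That this language is not
context-free follows from a pumping argument (`exists_length_le`).

The nested language has a grammar and a visibly pushdown automaton because its words grow from the
centre outwards (`NestedWord`). That no ADB accepts it is the main point. Suppose `A` does, and let
`K` be its largest delay. Since accepted words have as many `a` as `b`, a prefix of an accepting run
generates at most `N` more `a` than `b` (`exists_count_le`). Cut a run for a word with many long
blocks just before the first `b` is generated. Before the cut there are at most `N` letters `a`.
After it, every `a` is generated within `K` ticks, because no `a` may be output later than that `b`.

Hence each long `a`-block `i` repeats a triple of location, tick count and separator count, which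
yields a cycle without ticks and separators that generates an `a` of block `i`. Pumping the cycle
must also lengthen the opposite `b`-block, so the cycle itself generates a `b` of block `C - i`,
where `C` is the number of separators (`exists_opposite_delays`). There are only boundedly many
choices of tick offset, delay of the `a` and delay of the `b`, so two blocks `i < j` share one. But
among letters with a fixed output time, a later generation can only mean a block of larger or equal
index. The `a` then forces `i` to be generated first, whereas the `b`, for which the order of the
blocks is reversed, forces `j` first. -/

theorem Path.append {A : ADB α Q} {p q s : Q} {u v : List (ADBLabel α A.delays)}
    (hu : A.Path p u q) (hv : A.Path q v s) : A.Path p (u ++ v) s := by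
  induction hu with
  | nil p => exact hv
  | cons h _ ih => exact Path.cons h (ih hv)

/-- The ADB simulating a DFA: every letter is output without delay and time does not pass. -/
def ofDFA (M : DFA α Q) : ADB α Q where
  delays := {0}
  step q x := {q' | ∃ s d, x = ADBLabel.out s d ∧ q' = M.step q s}
  start := M.start
  accept := M.accept

/-- All timestamps are `0`, so the stamped list is already sorted and equals the output word. -/
theorem ofDFA_path {M : DFA α Q} {p q : Q} {r : List (ADBLabel α (ofDFA M).delays)}
    (h : (ofDFA M).Path p r q) :
    (stamp 0 r).Pairwise (fun x y => x.2 ≤ y.2) ∧ (∀ x ∈ stamp 0 r, x.2 = 0) ∧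
      M.evalFrom p ((stamp 0 r).map Prod.fst) = q := by
  induction h with
  | nil p => simp [stamp]
  | cons h _ ih =>
    obtain ⟨s, ⟨d, hd⟩, rfl, rfl⟩ := h
    obtain ⟨h1, h2, h3⟩ := ih
    obtain rfl : d = 0 := by simpa [ofDFA] using hd
    simp only [stamp, List.pairwise_cons, List.mem_cons, List.map_cons]
    refine ⟨⟨fun x hx => by simp, h1⟩, ?_, ?_⟩
    · rintro x (rfl | hx)
      · rfl
      · exact h2 x hx
    · simpa using h3

theorem ofDFA_exists_path (M : DFA α Q) (w : List α) (p : Q) :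
    ∃ r : List (ADBLabel α (ofDFA M).delays), (ofDFA M).Path p r (M.evalFrom p w) ∧
      (stamp 0 r).map Prod.fst = w := by
  induction w generalizing p with
  | nil => exact ⟨[], Path.nil _, rfl⟩
  | cons s w ih =>
    obtain ⟨r, hr, hw⟩ := ih (M.step p s)
    refine ⟨ADBLabel.out s ⟨0, by simp [ofDFA]⟩ :: r,
      Path.cons ⟨s, _, rfl, rfl⟩ (by simpa using hr), ?_⟩
    simp [stamp, hw]

theorem untimedLanguage_ofDFA (M : DFA α Q) : (ofDFA M).untimedLanguage = M.accepts := by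
  ext w
  constructor
  · rintro ⟨_, ⟨r, q, hq, hr, rfl⟩, rfl⟩
    obtain ⟨h1, -, h3⟩ := ofDFA_path hr
    have : oword r = stamp 0 r := h1.insertionSort_eq
    simp only [this]
    rw [DFA.mem_accepts]
    have h4 : M.eval ((stamp 0 r).map Prod.fst) = q := h3
    rw [h4]
    exact hq
  · intro hw
    obtain ⟨r, hr, h⟩ := ofDFA_exists_path M w M.start
    refine ⟨_, ⟨r, _, hw, hr, rfl⟩, ?_⟩
    have : oword r = stamp 0 r := (ofDFA_path hr).1.insertionSort_eq
    simp only [this, h]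

end ADB

theorem Language.IsRegular.isUntimedADBLanguage {α : Type*} {L : Language α} (h : L.IsRegular) :
    IsUntimedADBLanguage L := by
  obtain ⟨σ, _, M, rfl⟩ := h
  exact ⟨σ, inferInstance, ADB.ofDFA M, ADB.untimedLanguage_ofDFA M⟩

/-! ### The language of the words aⁿbⁿcⁿ: an ADB for it, and non-regularity -/

section Triple

variable {α : Type*} {a b c : α}

open ADB

/-- The ADB that cycles through the letters `a`, `b`, `c`, output with delays `0`, `1`, `2`. -/
def tripleADB (a b c : α) : ADB α (Fin 3) where
  delays := {0, 1, 2}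
  step q x := {q' | q' = q + 1 ∧ ∃ d, x = ADBLabel.out (![a, b, c] q) d ∧ (d : ℕ) = q}
  start := 0
  accept := {0}

/-- The stamped letters generated in `n` rounds of `tripleADB`. -/
def tripleRounds (a b c : α) : ℕ → List (α × ℕ)
  | 0 => []
  | n + 1 => (a, 0) :: (b, 1) :: (c, 2) :: tripleRounds a b c n

theorem orderedInsert_replicate_append {β : Type*} (f : β → ℕ) (x y : β) (h : f y < f x) (n : ℕ)
    (l : List β) :
    List.orderedInsert (fun p q => f p ≤ f q) x (List.replicate n y ++ l) =
      List.replicate n y ++ List.orderedInsert (fun p q => f p ≤ f q) x l := by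
  induction n with
  | zero => simp
  | succ n ih => simp [List.replicate_succ, ih, h]

theorem orderedInsert_replicate_self_append {β : Type*} (f : β → ℕ) (x : β) (n : ℕ)
    (l : List β) (h : ∀ y ∈ l, f x ≤ f y) :
    List.orderedInsert (fun p q => f p ≤ f q) x (List.replicate n x ++ l) =
      List.replicate (n + 1) x ++ l := by
  cases n with
  | zero =>
    cases l with
    | nil => simp
    | cons y l => simp [h y]
  | succ n => simp [List.replicate_succ]

/-- One more round inserts `c`, `b`, `a` in this order into the sorted list; each passes the blocks
with smaller stamps and joins the front of its own block. -/
theorem insertionSort_tripleRounds (n : ℕ) :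
    (tripleRounds a b c n).insertionSort (fun p q => p.2 ≤ q.2) =
      List.replicate n (a, 0) ++ (List.replicate n (b, 1) ++ List.replicate n (c, 2)) := by
  induction n with
  | zero => simp [tripleRounds]
  | succ n ih =>
    have hc := orderedInsert_replicate_self_append (Prod.snd : α × ℕ → ℕ) (c, 2) n [] (by simp)
    rw [List.append_nil, List.append_nil] at hc
    simp only [tripleRounds, List.insertionSort_cons, ih]
    rw [orderedInsert_replicate_append Prod.snd (c, 2) (a, 0) (by simp),
      orderedInsert_replicate_append Prod.snd (c, 2) (b, 1) (by simp), hc,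
      orderedInsert_replicate_append Prod.snd (b, 1) (a, 0) (by simp),
      orderedInsert_replicate_self_append Prod.snd (b, 1) n _ (by simp),
      orderedInsert_replicate_self_append Prod.snd (a, 0) n _ (by simp)]

theorem tripleADB_exists_path (n : ℕ) :
    ∃ r, (tripleADB a b c).Path 0 r 0 ∧ stamp 0 r = tripleRounds a b c n := by
  induction n with
  | zero => exact ⟨[], Path.nil _, rfl⟩
  | succ n ih =>
    obtain ⟨r, hr, h⟩ := ih
    refine ⟨.out a ⟨0, by simp [tripleADB]⟩ :: .out b ⟨1, by simp [tripleADB]⟩ ::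
      .out c ⟨2, by simp [tripleADB]⟩ :: r,
      Path.cons (p' := 1) ⟨rfl, _, rfl, rfl⟩ (Path.cons (p' := 2) ⟨rfl, _, rfl, rfl⟩
        (Path.cons (p' := 0) ⟨rfl, _, rfl, rfl⟩ hr)), ?_⟩
    simp [stamp, h, tripleRounds]

/-- The runs that start in the middle of a round are included to make the induction on the path go
through. -/
theorem tripleADB_path {p q : Fin 3} {r : List (ADBLabel α (tripleADB a b c).delays)}
    (h : (tripleADB a b c).Path p r q) (hq : q = 0) : ∃ n,
      (p = 0 → stamp 0 r = tripleRounds a b c n) ∧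
      (p = 1 → stamp 0 r = (b, 1) :: (c, 2) :: tripleRounds a b c n) ∧
      (p = 2 → stamp 0 r = (c, 2) :: tripleRounds a b c n) := by
  induction h with
  | nil p => subst hq; exact ⟨0, by simp [stamp, tripleRounds]⟩
  | @cons p _ _ _ r h _ ih =>
    obtain ⟨rfl, d, rfl, hd⟩ := h
    obtain ⟨n, h0, h1, h2⟩ := ih hq
    obtain rfl | rfl | rfl : p = 0 ∨ p = 1 ∨ p = 2 := by fin_cases p <;> simp
    · exact ⟨n + 1, by simpa [stamp, tripleRounds, hd] using h1⟩
    · exact ⟨n, by simpa [stamp, tripleRounds, hd] using h2⟩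
    · exact ⟨n, by simpa [stamp, tripleRounds, hd] using h0⟩

theorem isUntimedADBLanguage_tripleLanguage (a b c : α) :
    IsUntimedADBLanguage (tripleLanguage a b c) := by
  refine ⟨Fin 3, inferInstance, tripleADB a b c, ?_⟩
  ext w
  constructor
  · rintro ⟨_, ⟨r, q, hq, hr, rfl⟩, rfl⟩
    obtain ⟨n, h, -⟩ := tripleADB_path hr hq
    exact ⟨n, by simp [oword, h rfl, insertionSort_tripleRounds]⟩
  · rintro ⟨n, rfl⟩
    obtain ⟨r, hr, h⟩ := tripleADB_exists_path (a := a) (b := b) (c := c) n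
    exact ⟨_, ⟨r, 0, rfl, hr, rfl⟩, by simp [oword, h, insertionSort_tripleRounds]⟩

theorem not_isRegular_tripleLanguage (hab : a ≠ b) (hac : a ≠ c) :
    ¬ (tripleLanguage a b c).IsRegular := by
  classical
  rintro ⟨σ, _, M, hM⟩
  -- Two powers of `a` reach the same state, so the prefix `aⁱ` of `aⁱbⁱcⁱ` may be replaced by `aʲ`.
  obtain ⟨i, j, hij, h⟩ :=
    Finite.exists_ne_map_eq_of_infinite (fun i : ℕ => M.eval (List.replicate i a))
  have hi : List.replicate i a ++ (List.replicate i b ++ List.replicate i c) ∈ M.accepts := by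
    rw [hM]; exact ⟨i, by simp⟩
  have hj : List.replicate j a ++ (List.replicate i b ++ List.replicate i c) ∈ M.accepts := by
    rw [DFA.mem_accepts, DFA.eval, DFA.evalFrom_of_append] at hi ⊢
    simp only [DFA.eval] at h
    rwa [← h]
  rw [hM] at hj
  obtain ⟨n, hn⟩ := hj
  have h1 := congrArg (List.count a) hn
  have h2 := congrArg (List.count b) hn
  simp [List.count_replicate, hab, hab.symm, hac.symm] at h1 h2
  -- The case `c = b` is not excluded here; it only doubles the number of letters `b` on both sides.
  by_cases hbc : c = b
  · simp [hbc] at h2; omega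
  · simp [hbc] at h2; omega

end Triple

/-! ### A pumping argument for context-free grammars -/

namespace ContextFreeGrammar

variable {T : Type*} (g : ContextFreeGrammar T)

/-- `g.Yields F s w k`: there are derivation trees for the successive symbols of `s` with total
yield `w` and `k` inner nodes, none of which is labelled by a nonterminal in `F`. -/
inductive Yields (F : Set g.NT) : List (Symbol T g.NT) → List T → ℕ → Prop
  | nil : Yields F [] [] 0
  | terminal (t : T) {s : List (Symbol T g.NT)} {w : List T} {k : ℕ} (h : Yields F s w k) :
      Yields F (.terminal t :: s) (t :: w) k
  | nonterminal (r : ContextFreeRule T g.NT) (hr : r ∈ g.rules) (hF : r.input ∉ F)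
      {s : List (Symbol T g.NT)} {u v : List T} {k l : ℕ} (hu : Yields F r.output u k)
      (hv : Yields F s v l) : Yields F (.nonterminal r.input :: s) (u ++ v) (k + l + 1)

variable {g} {F : Set g.NT} {s s' : List (Symbol T g.NT)} {u v w : List T} {k l : ℕ}

theorem Yields.append (hu : g.Yields F s u k) (hv : g.Yields F s' v l) :
    ∃ j, g.Yields F (s ++ s') (u ++ v) j := by
  induction hu with
  | nil => exact ⟨l, hv⟩
  | terminal t _ ih => exact ⟨_, ih.choose_spec.terminal t⟩
  | nonterminal r hr hF hu _ _ ih =>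
    rw [List.append_assoc]
    exact ⟨_, Yields.nonterminal r hr hF hu ih.choose_spec⟩

theorem Yields.of_append : ∀ {s : List (Symbol T g.NT)} {w : List T} {k : ℕ},
    g.Yields F (s ++ s') w k →
      ∃ u v k l, w = u ++ v ∧ g.Yields F s u k ∧ g.Yields F s' v l
  | [], w, k, h => ⟨[], w, 0, k, rfl, .nil, h⟩
  | _ :: _, _, _, .terminal t h => by
    obtain ⟨u, v, k, l, rfl, hu, hv⟩ := Yields.of_append h
    exact ⟨_, _, _, _, rfl, hu.terminal t, hv⟩
  | _ :: _, _, _, .nonterminal r hr hF hu hv => by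
    obtain ⟨u', v, k, l, rfl, hu', hv⟩ := Yields.of_append hv
    exact ⟨_, _, _, _, by rw [List.append_assoc], .nonterminal r hr hF hu hu', hv⟩

theorem yields_map_terminal (w : List T) : g.Yields F (w.map .terminal) w 0 := by
  induction w with
  | nil => exact .nil
  | cons t w ih => exact ih.terminal t

/-- Going backwards along the derivation, the trees over the output of the applied rule become the
children of one new node. -/
theorem Derives.exists_yields (h : g.Derives s (w.map .terminal)) : ∃ k, g.Yields ∅ s w k := by
  induction h using Relation.ReflTransGen.head_induction_on with
  | refl => exact ⟨0, yields_map_terminal w⟩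
  | head h _ ih =>
    obtain ⟨r, hr, h⟩ := h
    obtain ⟨p, q, rfl, rfl⟩ := h.exists_parts
    obtain ⟨k, ih⟩ := ih
    obtain ⟨_, v, _, _, rfl, h1, hv⟩ := ih.of_append
    obtain ⟨u, u', _, _, rfl, hu, hu'⟩ := h1.of_append
    have := Yields.nonterminal r hr (Set.notMem_empty _) hu' (.nil)
    rw [List.append_nil] at this
    obtain ⟨_, h2⟩ := hu.append this
    exact h2.append hv

theorem derives_output {r : ContextFreeRule T g.NT} (hr : r ∈ g.rules) :
    g.Derives [.nonterminal r.input] r.output :=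
  Produces.single ⟨r, hr, ContextFreeRule.Rewrites.input_output⟩

theorem Derives.append {x x' y y' : List (Symbol T g.NT)} (hx : g.Derives x x')
    (hy : g.Derives y y') : g.Derives (x ++ y) (x' ++ y') :=
  (hx.append_right y).trans (hy.append_left x')

theorem Yields.derives (h : g.Yields F s w k) : g.Derives s (w.map .terminal) := by
  induction h with
  | nil => rfl
  | terminal t _ ih => exact ih.append_left [_]
  | nonterminal r hr _ _ _ ihu ihv =>
    rw [List.map_append]
    exact Derives.append (x := [_]) ((derives_output hr).trans ihu) ihv

/-- Either a nonterminal does not occur in a forest, or the forest factors through a tree rooted in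
that nonterminal. -/
theorem Yields.insert_or_factor (A : g.NT) (h : g.Yields F s w k) :
    g.Yields (insert A F) s w k ∨ ∃ y x z l, w = y ++ x ++ z ∧ l ≤ k ∧
      g.Derives s (y.map .terminal ++ [.nonterminal A] ++ z.map .terminal) ∧
      g.Yields F [.nonterminal A] x l := by
  induction h with
  | nil => exact .inl .nil
  | terminal t _ ih =>
    obtain ih | ⟨y, x, z, l, rfl, hl, hd, hx⟩ := ih
    · exact .inl (ih.terminal t)
    · exact .inr ⟨t :: y, x, z, l, by simp, hl, hd.append_left [_], hx⟩
  | @nonterminal r hr hF s u v k m hu hv ihu ihv =>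
    by_cases hA : r.input = A
    · refine .inr ⟨[], u, v, k + 0 + 1, by simp, by omega, ?_, ?_⟩
      · subst hA
        exact hv.derives.append_left [_]
      · subst hA
        simpa using Yields.nonterminal r hr hF hu .nil
    · obtain ihu | ⟨y, x, z, l, rfl, hl, hd, hx⟩ := ihu
      · obtain ihv | ⟨y, x, z, l, rfl, hl, hd, hx⟩ := ihv
        · exact .inl (.nonterminal r hr (by simp [hA, hF]) ihu ihv)
        · refine .inr ⟨u ++ y, x, z, l, by simp, by omega, ?_, hx⟩
          have := Derives.append (x := [_]) ((derives_output hr).trans hu.derives) hd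
          simpa using this
      · refine .inr ⟨y, x, z ++ v, l, by simp, by omega, ?_, hx⟩
        have := Derives.append (x := [_]) ((derives_output hr).trans hd) hv.derives
        simpa using this

/-- If every self-embedding of a nonterminal in the context of a derivation of a word is trivial,
then the words of the language have bounded length. -/
theorem exists_length_le
    (h : ∀ (A : g.NT) (p q y z x : List T),
      g.Derives [.nonterminal g.initial]
        (p.map .terminal ++ [.nonterminal A] ++ q.map .terminal) →
      g.Derives [.nonterminal A] (y.map .terminal ++ [.nonterminal A] ++ z.map .terminal) →
      g.Derives [.nonterminal A] (x.map .terminal) → y = [] ∧ z = []) :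
    ∃ N, ∀ w ∈ g.language, w.length ≤ N := by
  classical
  let I : Finset g.NT := g.rules.image ContextFreeRule.input
  -- `B` bounds the branching and is positive; `m F` counts the left-hand sides still allowed, and
  -- serves as the depth in the bound `B ^ m F`.
  let B : ℕ := g.rules.sup (fun r => r.output.length) + 1
  let m : Set g.NT → ℕ := fun F => (I.filter (· ∉ F)).card
  -- The outer induction is on the number of inner nodes, the inner one on the forest. Keeping `s`
  -- inside a sentential form is what makes `h` applicable to its nonterminals.
  have key : ∀ (K : ℕ) (F : Set g.NT) (s : List (Symbol T g.NT)) (w : List T) (k : ℕ), k < K →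
      g.Yields F s w k → (∃ p q : List T, g.Derives [.nonterminal g.initial]
        (p.map .terminal ++ s ++ q.map .terminal)) →
      w.length ≤ s.length * B ^ m F := by
    intro K
    induction K with
    | zero => exact fun _ _ _ k hk => absurd hk (Nat.not_lt_zero k)
    | succ K ihK =>
      intro F s w k hk hy hc
      have hB : 1 ≤ B ^ m F := Nat.one_le_pow _ _ (by simp [B])
      induction hy with
      | nil => simp
      | terminal t _ ih =>
        obtain ⟨p, q, hc⟩ := hc
        have := ih hk ⟨p ++ [t], q, by simpa using hc⟩
        simp only [List.length_cons]; nlinarith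
      | @nonterminal r hr hF s u v k l hu hv _ ih =>
        obtain ⟨p, q, hc⟩ := hc
        have hv' := ih (by omega) ⟨p ++ u, q, hc.trans (by
          have := Derives.append (Derives.refl (g := g) (p.map .terminal))
            (Derives.append (((derives_output hr).trans hu.derives).append_right s)
              (Derives.refl (g := g) (q.map .terminal)))
          simpa using this)⟩
        have hA : g.Derives [.nonterminal g.initial]
            (p.map .terminal ++ [.nonterminal r.input] ++ (v ++ q).map .terminal) := hc.trans (by
          have := Derives.append (Derives.refl (g := g) (p.map .terminal ++ [.nonterminal r.input]))
            (hv.derives.append_right (q.map .terminal))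
          simpa using this)
        suffices hu' : u.length ≤ B ^ m F by
          simp only [List.length_append, List.length_cons]; nlinarith
        -- If the root label does not recur below the root, it can be forbidden there and `m` drops.
        -- If it recurs, its context is trivial by `h`, so a tree with fewer nodes and the same root
        -- has the same yield.
        obtain hi | ⟨y, x, z, j, rfl, hj, hd, hx⟩ := hu.insert_or_factor r.input
        · have h1 := ihK _ _ _ _ (by omega) hi ⟨p, v ++ q, hA.trans
            (((derives_output hr).append_left _).append_right _)⟩
          have h2 : m (insert r.input F) + 1 ≤ m F := by
            rw [Nat.succ_le_iff]
            refine Finset.card_lt_card (Finset.ssubset_iff.2 ⟨r.input, by simp, ?_⟩)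
            intro A hA
            simp only [Finset.mem_insert, Finset.mem_filter, Set.mem_insert_iff, not_or] at hA ⊢
            rcases hA with rfl | ⟨hA, -, hA'⟩
            · exact ⟨Finset.mem_image_of_mem _ hr, hF⟩
            · exact ⟨hA, hA'⟩
          have h3 : r.output.length ≤ B :=
            (Finset.le_sup (f := fun r => r.output.length) hr).trans (Nat.le_succ _)
          calc u.length ≤ _ := h1
            _ ≤ B * B ^ m (insert r.input F) := Nat.mul_le_mul_right _ h3
            _ = B ^ (m (insert r.input F) + 1) := by rw [pow_succ']
            _ ≤ _ := Nat.pow_le_pow_right (by simp [B]) h2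
        · obtain ⟨rfl, rfl⟩ := h _ _ _ _ _ _ hA ((derives_output hr).trans hd) hx.derives
          have h1 := ihK _ _ _ _ (by omega) hx ⟨p, v ++ q, hA⟩
          simpa using h1
  refine ⟨1 * B ^ m ∅, fun w hw => ?_⟩
  obtain ⟨k, hk⟩ := Derives.exists_yields hw
  exact key (k + 1) _ _ _ k k.lt_succ_self hk ⟨[], [], by simpa using Derives.refl _⟩

end ContextFreeGrammar

/-! ### The language of the words aⁿbⁿcⁿ is not context-free -/

section Triple

variable {α : Type*} {a b c : α}

/-- Letters occur in the order `a`, `b`, `c`; the relation in `hp` expresses this order pairwise. -/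
theorem tripleLanguage_not_sublist_both (hab : a ≠ b) (hac : a ≠ c) (hbc : b ≠ c) {w : List α}
    (hw : w ∈ tripleLanguage a b c) {x y : α} (hxy : x ≠ y) (h1 : [x, y].Sublist w)
    (h2 : [y, x].Sublist w) : False := by
  have hp : w.Pairwise (fun x y => x = a ∨ (x = b ∧ y ≠ a) ∨ (x = c ∧ y = c)) := by
    obtain ⟨n, rfl⟩ := hw
    simp only [List.pairwise_append, List.pairwise_replicate, List.mem_append,
      List.mem_replicate]
    grind
  have h1 := hp.sublist h1
  have h2 := hp.sublist h2
  simp at h1 h2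
  grind

theorem tripleLanguage_count (hab : a ≠ b) (hac : a ≠ c) (hbc : b ≠ c) {w : List α}
    [DecidableEq α] (hw : w ∈ tripleLanguage a b c) : w.count a = w.count b ∧
      w.count b = w.count c ∧ w.length = w.count a + w.count b + w.count c := by
  obtain ⟨n, rfl⟩ := hw
  simp [List.count_replicate, hab, hac, hbc, hab.symm, hac.symm, hbc.symm]
  omega

theorem not_isContextFree_tripleLanguage (hab : a ≠ b) (hac : a ≠ c) (hbc : b ≠ c) :
    ¬ (tripleLanguage a b c).IsContextFree := by
  classical
  rintro ⟨g, hg⟩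
  suffices h : ∃ N, ∀ w ∈ g.language, w.length ≤ N by
    obtain ⟨N, hN⟩ := h
    have := hN (List.replicate (N + 1) a ++ List.replicate (N + 1) b ++ List.replicate (N + 1) c)
      (by rw [hg]; exact ⟨N + 1, rfl⟩)
    simp at this
    omega
  apply g.exists_length_le
  intro A p q y z x hp hy hx
  have h0 : p ++ x ++ q ∈ tripleLanguage a b c := by
    rw [← hg, ContextFreeGrammar.mem_language_iff]
    simpa using hp.trans ((hx.append_left (p.map .terminal)).append_right (q.map .terminal))
  have hx1 : g.Derives [.nonterminal A] ((y ++ x ++ z).map .terminal) := by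
    simpa using hy.trans ((hx.append_left (y.map .terminal)).append_right (z.map .terminal))
  have h1 : p ++ (y ++ x ++ z) ++ q ∈ tripleLanguage a b c := by
    rw [← hg, ContextFreeGrammar.mem_language_iff]
    simpa using hp.trans ((hx1.append_left (p.map .terminal)).append_right (q.map .terminal))
  have hx2 : g.Derives [.nonterminal A] ((y ++ (y ++ x ++ z) ++ z).map .terminal) := by
    simpa using hy.trans ((hx1.append_left (y.map .terminal)).append_right (z.map .terminal))
  have h2 : p ++ (y ++ (y ++ x ++ z) ++ z) ++ q ∈ tripleLanguage a b c := by
    rw [← hg, ContextFreeGrammar.mem_language_iff]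
    simpa using hp.trans ((hx2.append_left (p.map .terminal)).append_right (q.map .terminal))
  obtain ⟨e1, e2, e3⟩ := tripleLanguage_count hab hac hbc h0
  obtain ⟨f1, f2, f3⟩ := tripleLanguage_count hab hac hbc h1
  simp only [List.count_append, List.length_append] at e1 e2 e3 f1 f2 f3
  by_contra hne
  -- Comparing the counts with and without the pumped part, `y` and `z` together contain equally
  -- many `a`, `b`, `c` and nothing else, so all three letters occur.
  have hlen : 0 < y.length + z.length := by
    by_contra h
    exact hne ⟨List.length_eq_zero_iff.1 (by omega), List.length_eq_zero_iff.1 (by omega)⟩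
  have ha : a ∈ y ∨ a ∈ z := by simp only [← List.count_pos_iff]; omega
  have hb : b ∈ y ∨ b ∈ z := by simp only [← List.count_pos_iff]; omega
  have hc : c ∈ y ∨ c ∈ z := by simp only [← List.count_pos_iff]; omega
  -- Pumping twice puts `y ++ y` and `z ++ z` into a word of the language; distinct letters of `y`,
  -- or of `z`, would then occur in both orders. Two one-letter words cannot cover three letters.
  have key : ∀ u : List α, (u ++ u).Sublist (p ++ (y ++ (y ++ x ++ z) ++ z) ++ q) →
      ∀ s ∈ u, ∀ t ∈ u, s = t := by
    intro u hu s hs t ht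
    by_contra hst
    rw [← List.singleton_sublist] at hs ht
    exact tripleLanguage_not_sublist_both hab hac hbc h2 hst ((hs.append ht).trans hu)
      ((ht.append hs).trans hu)
  have hy' := key y (by
    refine List.Sublist.trans ?_ (List.sublist_append_left _ _)
    refine List.Sublist.trans ?_ (List.sublist_append_right _ _)
    simp)
  have hz' := key z (by
    refine List.Sublist.trans ?_ (List.sublist_append_left _ _)
    refine List.Sublist.trans ?_ (List.sublist_append_right _ _)
    rw [← List.append_assoc y]
    rw [List.append_sublist_append_right]
    exact List.sublist_append_right _ _)
  grind

end Triple

/-! ### The nested language: inductive description -/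

section Nested

variable {α : Type*} {a b h : α}

/-- The nonempty words of the nested language, generated from the centre outwards. -/
inductive NestedWord (a b h : α) : List α → Prop
  | base : NestedWord a b h [a, h, b]
  | grow {w : List α} (hw : NestedWord a b h w) : NestedWord a b h (a :: (w ++ [b]))
  | wrap {w : List α} (hw : NestedWord a b h w) : NestedWord a b h (a :: h :: (w ++ [h, b]))

theorem List.intercalate_append_singleton_of_ne_nil {ys l : List α} {zs : List (List α)}
    (hzs : zs ≠ []) : ys.intercalate (zs ++ [l]) = ys.intercalate zs ++ ys ++ l := by
  induction zs with
  | nil => exact absurd rfl hzs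
  | cons z zs ih =>
    rcases eq_or_ne zs [] with rfl | hne
    · simp
    · rw [List.cons_append, List.intercalate_cons_of_ne_nil (by simp), ih hne,
        List.intercalate_cons_of_ne_nil hne]
      simp

/-- The word `a^n₁ h ⋯ h a^nₘ h b^nₘ h ⋯ h b^n₁`. -/
def nestedBlocks (a b h : α) (ns : List ℕ) : List α :=
  List.intercalate [h] (ns.map (fun n => List.replicate n a) ++
    ns.reverse.map (fun n => List.replicate n b))

theorem nestedBlocks_singleton (n : ℕ) :
    nestedBlocks a b h [n] = List.replicate n a ++ [h] ++ List.replicate n b := by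
  simp [nestedBlocks]

theorem nestedBlocks_cons (n : ℕ) {ns : List ℕ} (hns : ns ≠ []) :
    nestedBlocks a b h (n :: ns) =
      List.replicate n a ++ [h] ++ nestedBlocks a b h ns ++ [h] ++ List.replicate n b := by
  have hne : ns.map (fun n => List.replicate n a) ++
      ns.reverse.map (fun n => List.replicate n b) ≠ [] := by simpa using hns
  have := List.intercalate_append_singleton_of_ne_nil (ys := [h]) (l := List.replicate n b)
    (zs := List.replicate n a :: (ns.map (fun n => List.replicate n a) ++
      ns.reverse.map (fun n => List.replicate n b))) (by simp)
  rw [List.intercalate_cons_of_ne_nil hne] at this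
  rw [nestedBlocks, nestedBlocks, ← this]
  simp

theorem nestedBlocks_succ (n : ℕ) (ns : List ℕ) :
    nestedBlocks a b h ((n + 1) :: ns) = a :: (nestedBlocks a b h (n :: ns) ++ [b]) := by
  rcases eq_or_ne ns [] with rfl | hne
  · rw [nestedBlocks_singleton, nestedBlocks_singleton, List.replicate_succ (a := a),
      List.replicate_succ' (a := b)]
    simp
  · rw [nestedBlocks_cons _ hne, nestedBlocks_cons _ hne, List.replicate_succ (a := a),
      List.replicate_succ' (a := b)]
    simp

/-- Peel the outermost pair of blocks: `grow` shortens it to length one, then `wrap` removes it with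
its separators. -/
theorem nestedWord_nestedBlocks : ∀ (ns : List ℕ), ns ≠ [] → (∀ n ∈ ns, 1 ≤ n) →
    NestedWord a b h (nestedBlocks a b h ns)
  | [], hne, _ => absurd rfl hne
  | n :: ns, _, hns => by
    obtain ⟨h1, h2⟩ := List.forall_mem_cons.1 hns
    induction n, h1 using Nat.le_induction with
    | base =>
      rcases eq_or_ne ns [] with rfl | hne
      · exact NestedWord.base
      · rw [nestedBlocks_cons _ hne]
        simpa using (nestedWord_nestedBlocks ns hne h2).wrap
    | succ n h1 ih =>
      rw [nestedBlocks_succ]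
      exact (ih (by simp) (List.forall_mem_cons.2 ⟨h1, h2⟩)).grow

theorem NestedWord.exists_nestedBlocks {w : List α} (hw : NestedWord a b h w) :
    ∃ n ns, (∀ k ∈ n :: ns, 1 ≤ k) ∧ w = nestedBlocks a b h (n :: ns) := by
  induction hw with
  | base => exact ⟨1, [], by simp, rfl⟩
  | grow _ ih =>
    obtain ⟨n, ns, h1, rfl⟩ := ih
    obtain ⟨-, h2⟩ := List.forall_mem_cons.1 h1
    exact ⟨n + 1, ns, List.forall_mem_cons.2 ⟨by omega, h2⟩, (nestedBlocks_succ n ns).symm⟩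
  | wrap _ ih =>
    obtain ⟨n, ns, h1, rfl⟩ := ih
    exact ⟨1, n :: ns, List.forall_mem_cons.2 ⟨le_rfl, h1⟩, by
      rw [nestedBlocks_cons 1 (by simp)]; simp⟩

theorem mem_nestedLanguage_iff {w : List α} :
    w ∈ nestedLanguage a b h ↔ w = [] ∨ NestedWord a b h w := by
  constructor
  · rintro ⟨ns, hns, rfl⟩
    rcases eq_or_ne ns [] with rfl | hne
    · exact .inl rfl
    · exact .inr (nestedWord_nestedBlocks ns hne hns)
  · rintro (rfl | hw)
    · exact ⟨[], by simp, rfl⟩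
    · obtain ⟨n, ns, h1, rfl⟩ := hw.exists_nestedBlocks
      exact ⟨_, h1, rfl⟩

/-- Input for `stamp_le_of_pairwise`, which turns the order of letters into an order of output
times. -/
theorem NestedWord.pairwise (hab : a ≠ b) (hah : a ≠ h) (hbh : b ≠ h) {w : List α}
    (hw : NestedWord a b h w) : w.Pairwise (fun x y => x = b → y ≠ a) := by
  induction hw with
  | base => simp [hab, hbh.symm]
  | grow _ ih => simp [List.pairwise_append, hab, hab.symm, ih]
  | wrap _ ih =>
    simp [List.pairwise_append, hab, hab.symm, hah.symm, hbh.symm, ih]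

/-! ### The nested language is context-free -/

/-- Nonterminals of the grammar of the nested language. -/
inductive NestedNT
  | start
  | nested

open Classical in
/-- The rules `S → ε | T`, `T → a h b | a T b | a h T h b`. -/
noncomputable def nestedRules (a b h : α) : Finset (ContextFreeRule α NestedNT) :=
  {⟨.start, []⟩, ⟨.start, [.nonterminal .nested]⟩,
    ⟨.nested, [.terminal a, .terminal h, .terminal b]⟩,
    ⟨.nested, [.terminal a, .nonterminal .nested, .terminal b]⟩,
    ⟨.nested, [.terminal a, .terminal h, .nonterminal .nested, .terminal h, .terminal b]⟩}

/-- The grammar of the nested language. -/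
noncomputable abbrev nestedGrammar (a b h : α) : ContextFreeGrammar α where
  NT := NestedNT
  initial := .start
  rules := nestedRules a b h

theorem NestedWord.derives {w : List α} (hw : NestedWord a b h w) :
    (nestedGrammar a b h).Derives [.nonterminal NestedNT.nested] (w.map .terminal) := by
  induction hw with
  | base =>
    exact ContextFreeGrammar.derives_output (g := nestedGrammar a b h)
      (r := ⟨.nested, [.terminal a, .terminal h, .terminal b]⟩) (by simp [nestedRules])
  | grow _ ih =>
    have := (ContextFreeGrammar.derives_output (g := nestedGrammar a b h)
      (r := ⟨.nested, [.terminal a, .nonterminal .nested, .terminal b]⟩)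
      (by simp [nestedRules])).trans ((ih.append_left [.terminal a]).append_right [.terminal b])
    simpa using this
  | wrap _ ih =>
    have := (ContextFreeGrammar.derives_output (g := nestedGrammar a b h)
      (r := ⟨.nested, [.terminal a, .terminal h, .nonterminal .nested, .terminal h, .terminal b]⟩)
      (by simp [nestedRules])).trans ((ih.append_left [.terminal a, .terminal h]).append_right
        [.terminal h, .terminal b])
    simpa using this

/-- The sentential forms of `nestedGrammar`. -/
def NestedForm (a b h : α) (s : List (Symbol α NestedNT)) : Prop :=
  s = [.nonterminal .start] ∨ s = [] ∨ (∃ w, NestedWord a b h w ∧ s = w.map .terminal) ∨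
    ∃ u v : List α, s = u.map .terminal ++ .nonterminal .nested :: v.map .terminal ∧
      ∀ w, NestedWord a b h w → NestedWord a b h (u ++ w ++ v)

theorem List.map_terminal_append_cons_nonterminal_inj {N : Type*} {u v : List α} {A B : N}
    {p q : List (Symbol α N)}
    (e : u.map .terminal ++ .nonterminal A :: v.map .terminal = p ++ .nonterminal B :: q) :
    p = u.map .terminal ∧ A = B ∧ q = v.map .terminal := by
  induction u generalizing p with
  | nil =>
    cases p with
    | nil => simp at e; simp [e]
    | cons x p =>
      simp only [List.map_nil, List.nil_append, List.cons_append, List.cons.injEq] at e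
      have : Symbol.nonterminal B ∈ v.map (Symbol.terminal (N := N)) := by simp [e.2]
      simp at this
  | cons x u ih =>
    cases p with
    | nil => simp at e
    | cons y p =>
      simp only [List.map_cons, List.cons_append, List.cons.injEq] at e
      obtain ⟨rfl, h2, h3⟩ := ih e.2
      simp [e.1, h2, h3]

/-- The invariant only says that the context of the nonterminal preserves nested words, so each rule
costs one use of `base`, `grow` or `wrap`. -/
theorem nestedForm_of_derives {s : List (Symbol α NestedNT)}
    (hs : (nestedGrammar a b h).Derives [.nonterminal NestedNT.start] s) :
    NestedForm a b h s := by
  induction hs with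
  | refl => exact .inl rfl
  | tail _ hp ih =>
    obtain ⟨r, hr, hp⟩ := hp
    obtain ⟨p, q, rfl, rfl⟩ := hp.exists_parts
    simp only [nestedRules, Finset.mem_insert, Finset.mem_singleton] at hr
    rcases ih with e | e | ⟨w, _, e⟩ | ⟨u, v, e, huv⟩
    · obtain ⟨rfl, hA, rfl⟩ := List.map_terminal_append_cons_nonterminal_inj
        (u := []) (v := []) (A := NestedNT.start) (B := r.input) (p := p) (q := q)
        (by simpa using e.symm)
      rcases hr with rfl | rfl | rfl | rfl | rfl
      · exact .inr (.inl rfl)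
      · exact .inr (.inr (.inr ⟨[], [], rfl, by simp⟩))
      all_goals cases hA
    · simp at e
    · have : Symbol.nonterminal r.input ∈ w.map (Symbol.terminal (N := NestedNT)) := by
        rw [← e]; simp
      simp at this
    · obtain ⟨rfl, hA, rfl⟩ := List.map_terminal_append_cons_nonterminal_inj
        (B := r.input) (p := p) (q := q) (by simpa using e.symm)
      rcases hr with rfl | rfl | rfl | rfl | rfl
      · cases hA
      · cases hA
      · exact .inr (.inr (.inl ⟨_, huv _ .base, by simp⟩))
      · exact .inr (.inr (.inr ⟨u ++ [a], b :: v, by simp, fun w hw => by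
          simpa using huv _ hw.grow⟩))
      · exact .inr (.inr (.inr ⟨u ++ [a, h], h :: b :: v, by simp, fun w hw => by
          simpa using huv _ hw.wrap⟩))

theorem isContextFree_nestedLanguage (a b h : α) : (nestedLanguage a b h).IsContextFree := by
  refine ⟨nestedGrammar a b h, ?_⟩
  ext w
  rw [ContextFreeGrammar.mem_language_iff, mem_nestedLanguage_iff]
  constructor
  · intro hw
    rcases nestedForm_of_derives hw with e | e | ⟨w', hw', e⟩ | ⟨u, v, e, huv⟩
    · cases w <;> simp at e
    · exact .inl (by simpa using e)
    · have hinj : Function.Injective (Symbol.terminal : α → Symbol α NestedNT) :=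
        fun x y hxy => by simpa using hxy
      exact .inr (List.map_injective_iff.2 hinj e ▸ hw')
    · have : Symbol.nonterminal NestedNT.nested ∈ w.map (Symbol.terminal (N := NestedNT)) := by
        rw [e]; simp
      simp at this
  · rintro (rfl | hw)
    · exact ContextFreeGrammar.derives_output (g := nestedGrammar a b h)
        (r := ⟨.start, []⟩) (by simp [nestedRules])
    · exact (ContextFreeGrammar.derives_output (g := nestedGrammar a b h)
        (r := ⟨.start, [.nonterminal .nested]⟩) (by simp [nestedRules])).trans hw.derives

/-! ### The nested language is visibly pushdown -/

/-- States of the visibly pushdown automaton of the nested language: the initial state, inside a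
block of calls, after the separator following such a block, inside a block of returns or before
one, after such a block, and the end of the word. -/
inductive NestedState
  | start
  | calls
  | callsSep
  | rets
  | retsSep
  | final
  deriving DecidableEq

instance : Finite NestedState :=
  Finite.of_surjective (![.start, .calls, .callsSep, .rets, .retsSep, .final] : Fin 6 → _)
    (by rintro (_ | _ | _ | _ | _ | _)
        exacts [⟨0, rfl⟩, ⟨1, rfl⟩, ⟨2, rfl⟩, ⟨3, rfl⟩, ⟨4, rfl⟩, ⟨5, rfl⟩])

/-- Stack symbols: they tell the first letter of the word, the first letter of another block, and
the other letters apart. -/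
inductive NestedStack
  | bot
  | first
  | rest

instance : Finite NestedStack :=
  Finite.of_surjective (![.bot, .first, .rest] : Fin 3 → _)
    (by rintro (_ | _ | _)
        exacts [⟨0, rfl⟩, ⟨1, rfl⟩, ⟨2, rfl⟩])

/-- The symbol pushed by a call. -/
def NestedState.push : NestedState → NestedStack
  | .start => .bot
  | .callsSep => .first
  | _ => .rest

/-- The state after popping a symbol. -/
def NestedStack.next : NestedStack → NestedState
  | .bot => .final
  | .first => .retsSep
  | .rest => .rets

open Classical in
/-- The visibly pushdown automaton of the nested language. -/
noncomputable def nestedVPA (a b : α) (h : α) : VPA α NestedState NestedStack where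
  kind x := if x = a then .call else if x = b then .ret else .internal
  init := {.start}
  accept := {.start, .final}
  callStep p _ := {q | (p = .start ∨ p = .calls ∨ p = .callsSep) ∧ q = (.calls, p.push)}
  retStep p _ g := {q | (p = .callsSep ∨ p = .rets) ∧ ∃ g', g = some g' ∧ q = g'.next}
  intStep p x := {q | x = h ∧ ((p = .calls ∧ q = .callsSep) ∨ (p = .retsSep ∧ q = .rets))}

theorem VPA.Reads.append {Q Γ : Type*} {M : VPA α Q Γ} {c c' c'' : Q × List Γ} {u v : List α}
    (hu : M.Reads c u c') (hv : M.Reads c' v c'') : M.Reads c (u ++ v) c'' := by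
  induction hu with
  | nil => exact hv
  | cons hs _ ih => exact .cons hs (ih hv)

theorem nestedVPA_step_call {p : NestedState} (hp : p = .start ∨ p = .calls ∨ p = .callsSep)
    (st : List NestedStack) : (nestedVPA a b h).Step (p, st) a (.calls, p.push :: st) :=
  .call (by simp [nestedVPA]) ⟨hp, rfl⟩

theorem nestedVPA_step_ret (hab : a ≠ b) {p : NestedState} (hp : p = .callsSep ∨ p = .rets)
    (g : NestedStack) (st : List NestedStack) :
    (nestedVPA a b h).Step (p, g :: st) b (g.next, st) :=
  .ret (by simp [nestedVPA, hab.symm]) ⟨hp, g, rfl, rfl⟩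

theorem nestedVPA_step_sep (hah : a ≠ h) (hbh : b ≠ h) {p q : NestedState}
    (hpq : (p = .calls ∧ q = .callsSep) ∨ (p = .retsSep ∧ q = .rets)) (st : List NestedStack) :
    (nestedVPA a b h).Step (p, st) h (q, st) :=
  .internal (by simp [nestedVPA, hah.symm, hbh.symm]) ⟨rfl, hpq⟩

/-- The first `a` pushes `p.push`, which the last `b` pops; the stack below is untouched. -/
theorem NestedWord.reads (hab : a ≠ b) (hah : a ≠ h) (hbh : b ≠ h) {w : List α}
    (hw : NestedWord a b h w) {p : NestedState} (hp : p = .start ∨ p = .calls ∨ p = .callsSep)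
    (st : List NestedStack) :
    (nestedVPA a b h).Reads (p, st) w (p.push.next, st) := by
  induction hw generalizing p st with
  | base =>
    exact .cons (nestedVPA_step_call hp st) (.cons (nestedVPA_step_sep hah hbh (by simp) _)
      (.cons (nestedVPA_step_ret hab (.inl rfl) _ _) (.nil _)))
  | grow _ ih =>
    exact .cons (nestedVPA_step_call hp st) ((ih (by simp) _).append
      (.cons (nestedVPA_step_ret hab (.inr rfl) _ _) (.nil _)))
  | wrap _ ih =>
    exact .cons (nestedVPA_step_call hp st) (.cons (nestedVPA_step_sep hah hbh (by simp) _)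
      ((ih (p := .callsSep) (by simp) _).append (.cons (nestedVPA_step_sep hah hbh
        (q := .rets) (.inr ⟨rfl, rfl⟩) _) (.cons (nestedVPA_step_ret hab (.inr rfl) _ _) (.nil _)))))

/-- The word still to be read from a state in the second half of the word. -/
def nestedRemaining (b h : α) : NestedState → List NestedStack → List α
  | .rets, .bot :: _ => [b]
  | .rets, .first :: st => b :: h :: nestedRemaining b h .rets st
  | .rets, .rest :: st => b :: nestedRemaining b h .rets st
  | .retsSep, st => h :: nestedRemaining b h .rets st
  | _, _ => []
-- The second component decreases when the separator is emitted and the stack stays the same.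
termination_by p st => (st.length, if p = .retsSep then 1 else 0)

theorem nestedRemaining_rets_cons (g : NestedStack) (st : List NestedStack) :
    nestedRemaining b h .rets (g :: st) = b :: nestedRemaining b h g.next st := by
  cases g <;> simp [nestedRemaining, NestedStack.next]

/-- The word `u`, read up to the end of an incomplete block of calls with stack `st`, can be
completed in the three possible ways. -/
def NestedPrefix (a b h : α) (u : List α) (st : List NestedStack) : Prop :=
  NestedWord a b h (u ++ h :: nestedRemaining b h .rets st) ∧
  ∀ w, NestedWord a b h w →
    NestedWord a b h (u ++ (w ++ nestedRemaining b h .rets st)) ∧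
    NestedWord a b h (u ++ h :: (w ++ h :: nestedRemaining b h .rets st))

/-- The invariant of the runs of `nestedVPA`: the word `u` may lead to the state `p` and the stack
`st`. -/
def NestedInvariant (a b h : α) (u : List α) : NestedState → List NestedStack → Prop
  | .start, st => u = [] ∧ st = []
  | .calls, st => NestedPrefix a b h u st
  | .callsSep, st => ∃ u', u = u' ++ [h] ∧ NestedPrefix a b h u' st
  | p, st => NestedWord a b h (u ++ nestedRemaining b h p st)

theorem NestedStack.invariant_next {u : List α} (g : NestedStack) (st : List NestedStack)
    (hu : NestedWord a b h (u ++ nestedRemaining b h g.next st)) :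
    NestedInvariant a b h u g.next st := by
  cases g <;> exact hu

theorem NestedInvariant.step {u : List α} {c c' : NestedState × List NestedStack} {x : α}
    (hu : NestedInvariant a b h u c.1 c.2) (hs : (nestedVPA a b h).Step c x c') :
    NestedInvariant a b h (u ++ [x]) c'.1 c'.2 := by
  cases hs with
  | @call p q x g st hk hq =>
    obtain rfl : x = a := by
      by_contra hx
      simp only [nestedVPA, hx, if_false] at hk
      split at hk <;> simp at hk
    obtain ⟨hp, hq⟩ := hq
    obtain ⟨rfl, rfl⟩ := Prod.mk.inj hq
    rcases hp with rfl | rfl | rfl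
    · obtain ⟨rfl, rfl⟩ := hu
      refine ⟨?_, fun w hw => ⟨?_, ?_⟩⟩
      · simpa [nestedRemaining, NestedState.push] using NestedWord.base
      · simpa [nestedRemaining, NestedState.push] using hw.grow
      · simpa [nestedRemaining, NestedState.push] using hw.wrap
    -- The three completions of `u ++ [a]` are completions of `u` with the words built by `base`,
    -- `grow` and `wrap`.
    · obtain ⟨-, hu⟩ := hu
      refine ⟨?_, fun w hw => ⟨?_, ?_⟩⟩
      · simpa [nestedRemaining, NestedState.push] using (hu _ .base).1
      · simpa [nestedRemaining, NestedState.push] using (hu _ hw.grow).1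
      · simpa [nestedRemaining, NestedState.push] using (hu _ hw.wrap).1
    · obtain ⟨u, rfl, -, hu⟩ := hu
      refine ⟨?_, fun w hw => ⟨?_, ?_⟩⟩
      · simpa [nestedRemaining, NestedState.push] using (hu _ .base).2
      · simpa [nestedRemaining, NestedState.push] using (hu _ hw.grow).2
      · simpa [nestedRemaining, NestedState.push] using (hu _ hw.wrap).2
  | @ret p q x g st hk hq =>
    obtain rfl : x = b := by
      by_contra hx
      simp only [nestedVPA, hx, if_false] at hk
      split at hk <;> simp at hk
    obtain ⟨hp, _, hg, rfl⟩ := hq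
    obtain rfl := Option.some.inj hg
    apply NestedStack.invariant_next
    rcases hp with rfl | rfl
    · obtain ⟨u, rfl, hu, -⟩ := hu
      simpa [nestedRemaining_rets_cons] using hu
    · simpa [NestedInvariant, nestedRemaining_rets_cons] using hu
  | retBottom _ hq => obtain ⟨-, _, hg, -⟩ := hq; cases hg
  | internal _ hq =>
    obtain ⟨rfl, ⟨rfl, rfl⟩ | ⟨rfl, rfl⟩⟩ := hq
    · exact ⟨u, rfl, hu⟩
    · simpa [NestedInvariant, nestedRemaining] using hu

theorem NestedInvariant.reads {u w : List α} {c c' : NestedState × List NestedStack}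
    (hw : (nestedVPA a b h).Reads c w c') (hu : NestedInvariant a b h u c.1 c.2) :
    NestedInvariant a b h (u ++ w) c'.1 c'.2 := by
  induction hw generalizing u with
  | nil => simpa using hu
  | cons hs _ ih => simpa using ih (hu.step hs)

theorem isVisiblyPushdownLanguage_nestedLanguage (hab : a ≠ b) (hah : a ≠ h) (hbh : b ≠ h) :
    IsVisiblyPushdownLanguage (nestedLanguage a b h) := by
  refine ⟨NestedState, NestedStack, inferInstance, inferInstance, nestedVPA a b h, ?_⟩
  ext w
  rw [mem_nestedLanguage_iff]
  constructor
  · rintro ⟨_, rfl, q, hq, st, hw⟩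
    have := NestedInvariant.reads (u := []) hw ⟨rfl, rfl⟩
    rcases hq with rfl | rfl
    · exact .inl this.1
    · exact .inr (by simpa [NestedInvariant, nestedRemaining] using this)
  · rintro (rfl | hw)
    · exact ⟨.start, rfl, .start, .inl rfl, [], .nil _⟩
    · exact ⟨.start, rfl, .final, .inr rfl, [], hw.reads hab hah hbh (.inl rfl) []⟩

end Nested

/-! ### Counting the letters of a block, in words and in stamped lists -/

section BlockCount

variable {α : Type*} [DecidableEq α] {a b h x : α} {i : ℕ}

/-- The number of occurrences of `x` in a word that are preceded by `i` separators `h`, where `k`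
separators precede the word. -/
def blockCount (h x : α) (i : ℕ) : ℕ → List α → ℕ
  | _, [] => 0
  | k, y :: w => (if y = x ∧ k = i then 1 else 0) + blockCount h x i (k + if y = h then 1 else 0) w

theorem blockCount_append (k : ℕ) (u v : List α) :
    blockCount h x i k (u ++ v) = blockCount h x i k u + blockCount h x i (k + u.count h) v := by
  induction u generalizing k with
  | nil => simp [blockCount]
  | cons y u ih =>
    simp only [List.cons_append, blockCount, ih, List.count_cons, beq_iff_eq]
    ring_nf

theorem blockCount_succ_succ (k : ℕ) (w : List α) :
    blockCount h x (i + 1) (k + 1) w = blockCount h x i k w := by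
  induction w generalizing k with
  | nil => rfl
  | cons y w ih => rw [blockCount, blockCount, add_right_comm k 1, ih]; simp

theorem blockCount_of_lt {k : ℕ} (w : List α) (hk : i < k) : blockCount h x i k w = 0 := by
  induction w generalizing k with
  | nil => rfl
  | cons y w ih => rw [blockCount, ih (by omega), if_neg (by omega)]

theorem blockCount_of_count_lt {k : ℕ} (w : List α) (hk : k + w.count h < i) :
    blockCount h x i k w = 0 := by
  induction w generalizing k with
  | nil => rfl
  | cons y w ih =>
    simp only [List.count_cons, beq_iff_eq] at hk
    rw [blockCount, ih (by omega), if_neg (by omega)]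

theorem blockCount_of_notMem {k : ℕ} (w : List α) (hx : x ∉ w) :
    blockCount h x i k w = 0 := by
  induction w generalizing k with
  | nil => rfl
  | cons y w ih =>
    simp only [List.mem_cons, not_or] at hx
    rw [blockCount, ih hx.2, if_neg (fun e => hx.1 e.1.symm)]

theorem blockCount_replicate_self (hxh : x ≠ h) (k n : ℕ) :
    blockCount h x i k (List.replicate n x) = if k = i then n else 0 := by
  induction n with
  | zero => simp [blockCount]
  | succ n ih =>
    rw [List.replicate_succ, blockCount, if_neg hxh, Nat.add_zero, ih]
    split <;> simp_all; omega

/-- `grow` adds one letter to each of the two outermost blocks; `wrap` shifts the old block indices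
by one and the separator count by two, so opposite blocks stay opposite. -/
theorem NestedWord.blockCount_eq (hab : a ≠ b) (hah : a ≠ h) (hbh : b ≠ h) {w : List α}
    (hw : NestedWord a b h w) (hi : i ≤ w.count h) :
    blockCount h a i 0 w = blockCount h b (w.count h - i) 0 w := by
  induction hw generalizing i with
  | base =>
    have hC : [a, h, b].count h = 1 := by simp [hah, hbh]
    rw [hC] at hi ⊢
    obtain rfl | rfl : i = 0 ∨ i = 1 := by omega
    all_goals simp [blockCount, hah, hab, hab.symm, hah.symm, hbh.symm]
  | @grow w _ ih =>
    have hC : (a :: (w ++ [b])).count h = w.count h := by simp [hah, hbh]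
    rw [hC] at hi ⊢
    simp [blockCount, blockCount_append, hah, hab, hab.symm, ih hi]
    split_ifs <;> omega
  | @wrap w _ ih =>
    have hC : (a :: h :: (w ++ [h, b])).count h = w.count h + 2 := by simp [hah, hbh]
    rw [hC] at hi ⊢
    simp [blockCount, blockCount_append, hah, hab, hab.symm, hah.symm, hbh.symm]
    obtain rfl | hi0 := Nat.eq_zero_or_pos i
    · rw [blockCount_of_lt _ one_pos, Nat.sub_zero, blockCount_succ_succ,
        blockCount_of_count_lt _ (by omega)]
      simp
      omega
    · obtain ⟨j, rfl⟩ := Nat.exists_eq_add_of_le' hi0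
      rw [blockCount_succ_succ, if_neg (by omega), if_neg (by omega), Nat.zero_add, Nat.add_zero]
      -- In the first case `i` is the index of the new last block, where both counts vanish.
      obtain hj | hj := Nat.lt_or_ge (w.count h) j
      · rw [blockCount_of_count_lt _ (by omega), blockCount_of_lt _ (by omega)]
      · rw [show w.count h + 2 - (j + Nat.succ 0) = w.count h - j + 1 by omega,
          blockCount_succ_succ, ih hj]

theorem NestedWord.count_eq (hab : a ≠ b) (hah : a ≠ h) (hbh : b ≠ h) {w : List α}
    (hw : NestedWord a b h w) : w.count a = w.count b := by
  induction hw with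
  | base => simp [hab, hab.symm, hah.symm, hbh.symm]
  | grow _ ih => simp [hab, hab.symm, ih]
  | wrap _ ih => simp [hab, hab.symm, hah.symm, hbh.symm, ih]

theorem count_nestedBlocks_replicate (hah : a ≠ h) (hbh : b ≠ h) (n m : ℕ) :
    (nestedBlocks a b h (List.replicate (m + 1) n)).count h = 2 * m + 1 := by
  induction m with
  | zero => simp [nestedBlocks_singleton, List.count_replicate, hah, hbh]
  | succ m ih =>
    rw [List.replicate_succ, nestedBlocks_cons n (by simp)]
    simp [List.count_replicate, hah, hbh, ih]
    omega

theorem blockCount_nestedBlocks_replicate (hab : a ≠ b) (hah : a ≠ h) (n : ℕ) {m : ℕ}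
    (hi : i ≤ m) : blockCount h a i 0 (nestedBlocks a b h (List.replicate (m + 1) n)) = n := by
  have hb : ∀ k, blockCount h a i k ([h] ++ List.replicate n b) = 0 := fun k =>
    blockCount_of_notMem _ (by simp [hah, hab, List.mem_replicate])
  induction m generalizing i with
  | zero =>
    obtain rfl : i = 0 := by omega
    rw [List.replicate_one, nestedBlocks_singleton, List.append_assoc, blockCount_append, hb,
      blockCount_replicate_self hah]
    simp
  | succ m ih =>
    rw [List.replicate_succ, nestedBlocks_cons n (by simp), List.append_assoc, blockCount_append,
      hb, blockCount_append, blockCount_append, blockCount_replicate_self hah]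
    simp only [List.count_append, List.count_replicate, List.count_singleton]
    obtain rfl | hi0 := Nat.eq_zero_or_pos i
    · rw [blockCount_of_lt (nestedBlocks a b h (List.replicate (m + 1) n)) (by simp [hah])]
      simp [blockCount, hah.symm]
    · obtain ⟨j, rfl⟩ := Nat.exists_eq_add_of_le' hi0
      simp [blockCount, hah.symm, hah]
      rw [blockCount_succ_succ]
      exact ih (by omega) (fun k => blockCount_of_notMem _
        (by simp [hah, hab, List.mem_replicate]))

/-- The number of separators `h` stamped with a time before `τ`. -/
def countBefore (h : α) (τ : ℕ) (l : List (α × ℕ)) : ℕ :=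
  l.countP (fun p => p.1 = h ∧ p.2 < τ)

/-- The number of separators `h` stamped with the time `τ`. -/
def countAt (h : α) (τ : ℕ) (l : List (α × ℕ)) : ℕ :=
  l.countP (fun p => p.1 = h ∧ p.2 = τ)

/-- The analogue of `blockCount` for a timed word, where `g τ` separators precede an initial letter
with time `τ`. -/
def timedBlockCount (h x : α) (i : ℕ) : (ℕ → ℕ) → List (α × ℕ) → ℕ
  | _, [] => 0
  | g, p :: l => (if p.1 = x ∧ g p.2 = i then 1 else 0) +
      timedBlockCount h x i (fun τ => g τ + if p.1 = h then 1 else 0) l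

/-- The analogue of `blockCount` for a list of stamped letters in generation order, where the number
of separators which precede a letter with time `τ` is `g τ` plus the number of separators with the
same time generated before. -/
def stampBlockCount (h x : α) (i : ℕ) : (ℕ → ℕ) → List (α × ℕ) → ℕ
  | _, [] => 0
  | g, p :: l => (if p.1 = x ∧ g p.2 = i then 1 else 0) +
      stampBlockCount h x i (fun τ => g τ + if p.1 = h ∧ p.2 = τ then 1 else 0) l

theorem timedBlockCount_const (k : ℕ) (l : List (α × ℕ)) :
    timedBlockCount h x i (fun _ => k) l = blockCount h x i k (l.map Prod.fst) := by
  induction l generalizing k with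
  | nil => rfl
  | cons p l ih => rw [timedBlockCount, ih, List.map_cons, blockCount]

theorem timedBlockCount_congr {g g' : ℕ → ℕ} {l : List (α × ℕ)} (hg : ∀ p ∈ l, g p.2 = g' p.2) :
    timedBlockCount h x i g l = timedBlockCount h x i g' l := by
  induction l generalizing g g' with
  | nil => rfl
  | cons p l ih =>
    rw [timedBlockCount, timedBlockCount, hg p (by simp)]
    congr 1
    exact ih (fun q hq => by simp [hg q (by simp [hq])])

/-- `p` lands behind exactly the letters with smaller times and before those with equal times, so it
is preceded by the separators counted by `countBefore` and, if it is a separator, shifts the letters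
with times at least its own. -/
theorem timedBlockCount_orderedInsert (g : ℕ → ℕ) (p : α × ℕ) {l : List (α × ℕ)}
    (hl : l.Pairwise (fun p q => p.2 ≤ q.2)) :
    timedBlockCount h x i g (l.orderedInsert (fun p q => p.2 ≤ q.2) p) =
      (if p.1 = x ∧ g p.2 + countBefore h p.2 l = i then 1 else 0) +
      timedBlockCount h x i (fun τ => g τ + if p.1 = h ∧ p.2 ≤ τ then 1 else 0) l := by
  induction l generalizing g with
  | nil => simp [timedBlockCount, countBefore]
  | cons q l ih =>
    rw [List.pairwise_cons] at hl
    by_cases hpq : p.2 ≤ q.2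
    · rw [List.orderedInsert_cons_of_le (fun p q : α × ℕ => p.2 ≤ q.2) _ hpq, timedBlockCount]
      have h1 : ∀ q' ∈ q :: l, p.2 ≤ q'.2 := by
        rintro q' (_ | ⟨_, hq'⟩)
        · exact hpq
        · exact hpq.trans (hl.1 q' hq')
      have h2 : countBefore h p.2 (q :: l) = 0 := by
        rw [countBefore, List.countP_eq_zero]
        intro q' hq'
        have := h1 q' hq'
        simp
        omega
      rw [h2, Nat.add_zero]
      congr 1
      exact timedBlockCount_congr (fun q' hq' => by simp [h1 q' hq'])
    · rw [List.orderedInsert_of_not_le (fun p q : α × ℕ => p.2 ≤ q.2) _ hpq, timedBlockCount, ih _ hl.2, timedBlockCount]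
      simp only [hpq, and_false, if_false, Nat.add_zero]
      have h1 : countBefore h p.2 (q :: l) = (if q.1 = h then 1 else 0) + countBefore h p.2 l := by
        have : q.2 < p.2 := by omega
        simp [countBefore, List.countP_cons, this, add_comm]
      rw [h1, add_left_comm, add_assoc]
      simp only [add_right_comm]

theorem timedBlockCount_insertionSort (g : ℕ → ℕ) (l : List (α × ℕ)) :
    timedBlockCount h x i g (l.insertionSort (fun p q => p.2 ≤ q.2)) =
      stampBlockCount h x i (fun τ => g τ + countBefore h τ l) l := by
  induction l generalizing g with
  | nil => rfl
  | cons p l ih =>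
    have hs : (l.insertionSort (fun p q => p.2 ≤ q.2)).Pairwise (fun p q => p.2 ≤ q.2) :=
      haveI : IsTrans (α × ℕ) (fun p q => p.2 ≤ q.2) := ⟨fun _ _ _ => le_trans⟩
      haveI : Std.Total (fun p q : α × ℕ => p.2 ≤ q.2) := ⟨fun _ _ => le_total _ _⟩
      List.pairwise_insertionSort _ l
    rw [List.insertionSort_cons, timedBlockCount_orderedInsert _ _ hs, ih, stampBlockCount]
    have h1 : countBefore h p.2 (l.insertionSort (fun p q => p.2 ≤ q.2)) =
        countBefore h p.2 (p :: l) := by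
      rw [countBefore, (List.perm_insertionSort _ l).countP_eq]
      simp [countBefore]
    rw [h1]
    congr 2
    funext τ
    -- A separator `p` with `p.2 ≤ τ` is counted by `countBefore` if `p.2 < τ`, and by the running
    -- count of `stampBlockCount` if `p.2 = τ`.
    simp only [countBefore, List.countP_cons, decide_eq_true_eq]
    by_cases hp : p.1 = h
    · simp only [hp, true_and]
      split_ifs <;> omega
    · simp [hp]

/-- The blocks of the word obtained from a list of stamped letters by sorting. -/
theorem blockCount_insertionSort (l : List (α × ℕ)) :
    blockCount h x i 0 ((l.insertionSort (fun p q => p.2 ≤ q.2)).map Prod.fst) =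
      stampBlockCount h x i (fun τ => countBefore h τ l) l := by
  rw [← timedBlockCount_const, timedBlockCount_insertionSort]
  simp

theorem countAt_append (τ : ℕ) (l l' : List (α × ℕ)) :
    countAt h τ (l ++ l') = countAt h τ l + countAt h τ l' := List.countP_append

theorem stampBlockCount_append (g : ℕ → ℕ) (l l' : List (α × ℕ)) :
    stampBlockCount h x i g (l ++ l') = stampBlockCount h x i g l +
      stampBlockCount h x i (fun τ => g τ + countAt h τ l) l' := by
  induction l generalizing g with
  | nil => simp [stampBlockCount, countAt]
  | cons p l ih =>
    rw [List.cons_append, stampBlockCount, ih, stampBlockCount, add_assoc]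
    congr 3
    funext τ
    simp only [countAt, List.countP_cons, decide_eq_true_eq]
    omega

theorem stampBlockCount_le_count (g : ℕ → ℕ) (l : List (α × ℕ)) :
    stampBlockCount h x i g l ≤ (l.map Prod.fst).count x := by
  induction l generalizing g with
  | nil => simp [stampBlockCount]
  | cons p l ih =>
    rw [stampBlockCount, List.map_cons, List.count_cons, add_comm]
    refine Nat.add_le_add (ih _) ?_
    by_cases hp : p.1 = x <;> simp [hp]
    split <;> simp

theorem countAt_eq_zero {l : List (α × ℕ)} (hl : h ∉ l.map Prod.fst) (τ : ℕ) :
    countAt h τ l = 0 := by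
  rw [countAt, List.countP_eq_zero]
  rintro ⟨y, t⟩ hy
  simp only [decide_eq_true_eq, not_and]
  rintro rfl
  exact absurd (List.mem_map_of_mem (f := Prod.fst) hy) hl

theorem countBefore_eq_zero {l : List (α × ℕ)} (hl : h ∉ l.map Prod.fst) (τ : ℕ) :
    countBefore h τ l = 0 := by
  rw [countBefore, List.countP_eq_zero]
  rintro ⟨y, t⟩ hy
  simp only [decide_eq_true_eq, not_and]
  rintro rfl
  exact absurd (List.mem_map_of_mem (f := Prod.fst) hy) hl

theorem stampBlockCount_pos_iff (g : ℕ → ℕ) {l : List (α × ℕ)} (hl : h ∉ l.map Prod.fst) :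
    0 < stampBlockCount h x i g l ↔ ∃ τ, (x, τ) ∈ l ∧ g τ = i := by
  induction l generalizing g with
  | nil => simp [stampBlockCount]
  | cons p l ih =>
    simp only [List.map_cons, List.mem_cons, not_or] at hl
    have hne : p.1 ≠ h := fun e => hl.1 e.symm
    rw [stampBlockCount]
    simp only [hne, false_and, if_false, Nat.add_zero, Nat.add_pos_iff_pos_or_pos]
    rw [ih _ hl.2]
    constructor
    · rintro (hp | ⟨τ, h1, h2⟩)
      · refine ⟨p.2, ?_⟩
        split_ifs at hp with hp'
        · exact ⟨by simp [← hp'.1], hp'.2⟩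
        · simp at hp
      · exact ⟨τ, by simp [h1], h2⟩
    · rintro ⟨τ, h1, h2⟩
      rcases List.mem_cons.1 h1 with rfl | h1
      · simp [h2]
      · exact .inr ⟨τ, h1, h2⟩

theorem nestedLanguage_blockCount_eq (hab : a ≠ b) (hah : a ≠ h) (hbh : b ≠ h) {w : List α}
    (hw : w ∈ nestedLanguage a b h) (hi : i ≤ w.count h) :
    blockCount h a i 0 w = blockCount h b (w.count h - i) 0 w := by
  rcases mem_nestedLanguage_iff.1 hw with rfl | hw
  · rfl
  · exact hw.blockCount_eq hab hah hbh hi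

/-- If letters generated at one time can be pumped in the nested language and one of them belongs to
the `i`-th block, then another one belongs to the opposite block. -/
theorem exists_mem_opposite_block (hab : a ≠ b) (hah : a ≠ h) (hbh : b ≠ h)
    {u v y : List (α × ℕ)} (hv : h ∉ v.map Prod.fst)
    (h1 : ((u ++ (v ++ y)).insertionSort (fun p q => p.2 ≤ q.2)).map Prod.fst ∈
      nestedLanguage a b h)
    (h2 : ((u ++ (v ++ (v ++ y))).insertionSort (fun p q => p.2 ≤ q.2)).map Prod.fst ∈
      nestedLanguage a b h)
    {τ : ℕ} (hτ : (a, τ) ∈ v)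
    (hi : countBefore h τ (u ++ (v ++ y)) + countAt h τ u = i)
    (hC : i ≤ ((u ++ (v ++ y)).map Prod.fst).count h) :
    ∃ τ', (b, τ') ∈ v ∧ countBefore h τ' (u ++ (v ++ y)) + countAt h τ' u =
      ((u ++ (v ++ y)).map Prod.fst).count h - i := by
  have hcount : ∀ l : List (α × ℕ),
      ((l.insertionSort (fun p q => p.2 ≤ q.2)).map Prod.fst).count h = (l.map Prod.fst).count h :=
    fun l => ((List.perm_insertionSort _ l).map _).count_eq h
  have hC' : ((u ++ (v ++ (v ++ y))).map Prod.fst).count h =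
      ((u ++ (v ++ y)).map Prod.fst).count h := by
    simp only [List.map_append, List.count_append, List.count_eq_zero.2 hv]
    omega
  have hB : ∀ τ, countBefore h τ (u ++ (v ++ (v ++ y))) = countBefore h τ (u ++ (v ++ y)) := by
    intro τ
    have := countBefore_eq_zero hv τ
    simp only [countBefore, List.countP_append] at this ⊢
    omega
  have e1 := nestedLanguage_blockCount_eq hab hah hbh h1 (i := i) (by rwa [hcount])
  have e2 := nestedLanguage_blockCount_eq hab hah hbh h2 (i := i) (by rwa [hcount, hC'])
  rw [hcount, blockCount_insertionSort, blockCount_insertionSort] at e1 e2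
  rw [hC'] at e2
  simp only [hB] at e2
  simp only [stampBlockCount_append, countAt_eq_zero hv, Nat.add_zero] at e1 e2
  -- Without separators in `v`, both copies of `v` contribute alike and the contributions of `u` and
  -- `y` are unchanged. So `e1` and `e2` give equality of the two contributions of `v`, and the one
  -- for `a` is positive.
  have e3 := (stampBlockCount_pos_iff
    (fun τ => countBefore h τ (u ++ (v ++ y)) + countAt h τ u) hv).2 ⟨τ, hτ, hi⟩
  exact (stampBlockCount_pos_iff
    (fun τ => countBefore h τ (u ++ (v ++ y)) + countAt h τ u) hv).1 (by omega)

end BlockCount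

/-! ### Runs: ticks, generated letters and locations -/

namespace ADB

variable {α : Type*} {Q : Type*} {D : Finset ℕ}

/-- The number of ticks in a sequence of labels. -/
def ticks : List (ADBLabel α D) → ℕ
  | [] => 0
  | .out _ _ :: r => ticks r
  | .eps :: r => ticks r
  | .tick :: r => ticks r + 1

theorem ticks_append (u v : List (ADBLabel α D)) : ticks (u ++ v) = ticks u + ticks v := by
  induction u with
  | nil => simp [ticks]
  | cons x u ih => cases x <;> simp [ticks, ih]; omega

theorem stamp_append (t : ℕ) (u v : List (ADBLabel α D)) :
    stamp t (u ++ v) = stamp t u ++ stamp (t + ticks u) v := by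
  induction u generalizing t with
  | nil => simp [stamp, ticks]
  | cons x u ih => cases x <;> simp [stamp, ticks, ih, add_assoc, add_comm 1]

/-- The letters generated by a sequence of labels. -/
def letters (r : List (ADBLabel α D)) : List α :=
  (stamp 0 r).map Prod.fst

theorem map_fst_stamp (t : ℕ) (r : List (ADBLabel α D)) :
    (stamp t r).map Prod.fst = letters r := by
  have : ∀ t t' : ℕ, (stamp t r).map Prod.fst = (stamp t' r).map Prod.fst := by
    induction r with
    | nil => simp [stamp]
    | cons x r ih =>
      intro t t'
      cases x
      · simp [stamp, ih t t']
      · exact ih t t'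
      · exact ih _ _
  exact this t 0

theorem letters_append (u v : List (ADBLabel α D)) : letters (u ++ v) = letters u ++ letters v := by
  rw [letters, stamp_append, List.map_append, map_fst_stamp, map_fst_stamp]

theorem oword_perm_letters (r : List (ADBLabel α D)) :
    ((oword r).map Prod.fst).Perm (letters r) :=
  (List.perm_insertionSort _ _).map _

theorem oword_pairwise (r : List (ADBLabel α D)) :
    (oword r).Pairwise (fun p q => p.2 ≤ q.2) :=
  haveI : IsTrans (α × ℕ) (fun p q => p.2 ≤ q.2) := ⟨fun _ _ _ => le_trans⟩
  haveI : Std.Total (fun p q : α × ℕ => p.2 ≤ q.2) := ⟨fun _ _ => le_total _ _⟩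
  List.pairwise_insertionSort _ _

theorem exists_first_out {b : α} {r : List (ADBLabel α D)} (hb : b ∈ letters r) :
    ∃ r₁ d r₂, r = r₁ ++ .out b d :: r₂ ∧ b ∉ letters r₁ := by
  induction r with
  | nil => simp [letters, stamp] at hb
  | cons x r ih =>
    by_cases hx : ∃ d, x = .out b d
    · obtain ⟨d, rfl⟩ := hx
      exact ⟨[], d, r, rfl, by simp [letters, stamp]⟩
    · have hb' : ∀ r : List (ADBLabel α D), b ∈ letters (x :: r) ↔ b ∈ letters r := by
        intro r
        cases x with
        | out s d =>
          have hs : b ≠ s := fun e => hx ⟨d, by rw [e]⟩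
          simp only [letters, stamp, List.map_cons, List.mem_cons, hs, false_or]
        | eps => rfl
        | tick => simp only [letters, stamp]; rw [map_fst_stamp]; rfl
      obtain ⟨r₁, d, r₂, rfl, h⟩ := ih ((hb' r).1 hb)
      exact ⟨x :: r₁, d, r₂, rfl, fun h' => h ((hb' r₁).1 h')⟩

theorem exists_delay_of_mem_stamp {t : ℕ} {r : List (ADBLabel α D)} (hr : ticks r = 0)
    {p : α × ℕ} (hp : p ∈ stamp t r) : ∃ d : D, p.2 = t + d := by
  induction r with
  | nil => simp [stamp] at hp
  | cons x r ih =>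
    cases x with
    | out s d =>
      rcases List.mem_cons.1 hp with rfl | hp
      · exact ⟨d, rfl⟩
      · exact ih hr hp
    | eps => exact ih hr hp
    | tick => simp [ticks] at hr

/-- In a run whose word has no `b` before an `a`, every `a` is stamped no later than every `b`. -/
theorem stamp_le_of_pairwise {a b : α} {r : List (ADBLabel α D)}
    (hr : ((oword r).map Prod.fst).Pairwise (fun x y => x = b → y ≠ a)) {τ τ' : ℕ}
    (ha : (a, τ) ∈ stamp 0 r) (hb : (b, τ') ∈ stamp 0 r) (hab : a ≠ b) : τ ≤ τ' := by
  by_contra! hlt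
  rw [← (List.perm_insertionSort (fun p q : α × ℕ => p.2 ≤ q.2) _).mem_iff] at ha hb
  obtain ⟨i, hi, ei⟩ := List.getElem_of_mem ha
  obtain ⟨j, hj, ej⟩ := List.getElem_of_mem hb
  rcases lt_trichotomy i j with hij | rfl | hij
  · have := List.pairwise_iff_getElem.1 (oword_pairwise r) i j hi hj hij
    simp only [oword, ei, ej] at this
    omega
  · exact hab (congrArg Prod.fst (ei.symm.trans ej))
  · rw [List.pairwise_map] at hr
    have := List.pairwise_iff_getElem.1 hr j i hj hi hij
    simp [oword, ei, ej] at this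

/-- The sequence of locations of a run. -/
theorem Path.exists_locations {A : ADB α Q} {p q : Q} {r : List (ADBLabel α A.delays)}
    (hr : A.Path p r q) : ∃ st : ℕ → Q, st 0 = p ∧ st r.length = q ∧
      ∀ i j, i ≤ j → j ≤ r.length → A.Path (st i) ((r.take j).drop i) (st j) := by
  induction hr with
  | nil p =>
    refine ⟨fun _ => p, rfl, rfl, fun i j _ _ => ?_⟩
    simpa using Path.nil p
  | @cons p p' q x r h hr ih =>
    obtain ⟨st, h0, h1, hst⟩ := ih
    refine ⟨fun k => k.casesOn p st, rfl, h1, fun i j hij hj => ?_⟩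
    cases j with
    | zero =>
      obtain rfl : i = 0 := by omega
      exact Path.nil p
    | succ j =>
      have hj' : j ≤ r.length := by simpa using hj
      cases i with
      | zero =>
        have := hst 0 j (Nat.zero_le j) hj'
        rw [h0] at this
        exact Path.cons h (by simpa using this)
      | succ i => simpa using hst i j (by omega) hj'

open Classical in
/-- Letters counted by their positions in a sequence of labels. -/
theorem stampBlockCount_stamp [DecidableEq α] {h x : α} {i : ℕ} (g : ℕ → ℕ) (t : ℕ)
    (r : List (ADBLabel α D)) :
    stampBlockCount h x i g (stamp t r) = ((Finset.range r.length).filter (fun k => ∃ d : D,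
      r[k]? = some (.out x d) ∧ g (t + ticks (r.take k) + d) +
        countAt h (t + ticks (r.take k) + d) (stamp t (r.take k)) = i)).card := by
  rw [Finset.card_filter]
  induction r generalizing g t with
  | nil => rfl
  | cons y r ih =>
    rw [List.length_cons, Finset.sum_range_succ']
    cases y with
    | out s d =>
      rw [stamp, stampBlockCount, ih, add_comm]
      congr 1
      · refine Finset.sum_congr rfl fun k _ => ?_
        congr 1
        simp only [List.getElem?_cons_succ, List.take_succ_cons, ticks, stamp, countAt,
          List.countP_cons, decide_eq_true_eq, eq_iff_iff]
        refine exists_congr fun d' => and_congr_right fun _ => ?_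
        rw [add_right_comm, add_assoc]
      · congr 1
        simp [ticks, stamp, countAt]
    | eps =>
      rw [stamp, ih]
      simp [ticks, stamp]
    | tick =>
      rw [stamp, ih]
      have ht : ∀ k, t + (ticks (r.take k) + 1) = t + 1 + ticks (r.take k) := fun k => by omega
      simp [ticks, stamp, ht]

theorem Path.exists_of_append {A : ADB α Q} {p s : Q} {u v : List (ADBLabel α A.delays)}
    (h : A.Path p (u ++ v) s) : ∃ q, A.Path p u q ∧ A.Path q v s := by
  induction u generalizing p with
  | nil => exact ⟨p, .nil p, h⟩
  | cons x u ih =>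
    cases h with
    | cons hx h =>
      obtain ⟨q, h1, h2⟩ := ih h
      exact ⟨q, .cons hx h1, h2⟩

/-- If all words of an ADB have as many letters `a` as `b`, then the number of letters `a` generated
by an initial part of a run is bounded in terms of the number of letters `b`. -/
theorem exists_count_le [DecidableEq α] [Finite Q] {a b : α} {A : ADB α Q}
    (hA : ∀ r, ∀ q ∈ A.accept, A.Path A.start r q → (letters r).count a = (letters r).count b) :
    ∃ N, ∀ u q v, ∀ s ∈ A.accept, A.Path A.start u q → A.Path q v s →
      (letters u).count a ≤ (letters u).count b + N := by
  have hq : ∀ q, ∃ N, ∀ u v, ∀ s ∈ A.accept, A.Path A.start u q → A.Path q v s →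
      (letters u).count a ≤ (letters u).count b + N := by
    intro q
    by_cases hq : ∃ v, ∃ s ∈ A.accept, A.Path q v s
    -- One fixed accepting continuation `v` of `q` serves for all prefixes that reach `q`.
    · obtain ⟨v, s, hs, hv⟩ := hq
      refine ⟨(letters v).count b, fun u _ _ _ hu _ => ?_⟩
      have := hA _ _ hs (hu.append hv)
      simp only [letters_append, List.count_append] at this
      omega
    · exact ⟨0, fun u v s hs _ hv => absurd ⟨v, s, hs, hv⟩ hq⟩
  choose N hN using hq
  have := Fintype.ofFinite Q
  exact ⟨Finset.univ.sup N, fun u q v s hs hu hv => (hN q u v s hs hu hv).trans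
    (Nat.add_le_add_left (Finset.le_sup (f := N) (Finset.mem_univ q)) _)⟩

end ADB

/-! ### The nested language is not an untimed ADB language -/

section NotADB

open ADB

variable {α : Type*} {a b h : α}

/-- If a block of letters `a` is long, then a cycle without ticks and separators generates some of
them and hence, at the same time, letters `b` of the opposite block. -/
theorem exists_opposite_delays [DecidableEq α] (hab : a ≠ b) (hah : a ≠ h) (hbh : b ≠ h)
    {Q : Type*} [Fintype Q] {A : ADB α Q} (hA : A.untimedLanguage = nestedLanguage a b h)
    {r₁ r₂ : List (ADBLabel α A.delays)} {q s : Q} (hr₁ : A.Path A.start r₁ q)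
    (hr₂ : A.Path q r₂ s) (hs : s ∈ A.accept) {K : ℕ}
    (hK : ∀ k d, r₂[k]? = some (.out a d) → ticks (r₂.take k) ≤ K) {i C : ℕ}
    (hC : (letters (r₁ ++ r₂)).count h = C) (hi : i ≤ C)
    (hcard : Fintype.card Q * ((K + 1) * (C + 1)) < stampBlockCount h a i
      (fun τ => countBefore h τ (stamp 0 (r₁ ++ r₂)) + countAt h τ (stamp 0 r₁))
      (stamp (ticks r₁) r₂)) :
    ∃ (k : ℕ) (d d' : A.delays), ticks (r₂.take k) ≤ K ∧
      countBefore h (ticks r₁ + ticks (r₂.take k) + d) (stamp 0 (r₁ ++ r₂)) +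
        countAt h (ticks r₁ + ticks (r₂.take k) + d) (stamp 0 (r₁ ++ r₂.take k)) = i ∧
      countBefore h (ticks r₁ + ticks (r₂.take k) + d') (stamp 0 (r₁ ++ r₂)) +
        countAt h (ticks r₁ + ticks (r₂.take k) + d') (stamp 0 (r₁ ++ r₂.take k)) = C - i := by
  classical
  obtain ⟨st, h0, h1, hst⟩ := hr₂.exists_locations
  rw [stampBlockCount_stamp] at hcard
  obtain ⟨S, hcard, hS⟩ : ∃ S : Finset ℕ, Fintype.card Q * ((K + 1) * (C + 1)) < S.card ∧
      ∀ k ∈ S, k < r₂.length ∧ ∃ d : A.delays, r₂[k]? = some (.out a d) ∧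
        countBefore h (ticks r₁ + ticks (r₂.take k) + d) (stamp 0 (r₁ ++ r₂)) +
          countAt h (ticks r₁ + ticks (r₂.take k) + d) (stamp 0 r₁) +
          countAt h (ticks r₁ + ticks (r₂.take k) + d) (stamp (ticks r₁) (r₂.take k)) = i :=
    ⟨_, hcard, fun k hk => by
      obtain ⟨h1, h2⟩ := Finset.mem_filter.1 hk
      exact ⟨Finset.mem_range.1 h1, h2⟩⟩
  have hcount : ∀ k, (letters (r₂.take k)).count h ≤ C := by
    intro k
    rw [← hC]
    conv_rhs => rw [← List.take_append_drop k r₂, letters_append, letters_append]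
    simp only [List.count_append]
    omega
  -- Pigeonhole on location, ticks and generated separators. Equal tick and separator counts mean
  -- that the cycle between the two positions contains neither ticks nor separators.
  obtain ⟨k, hk, e, he, hke, heq⟩ : ∃ k ∈ S, ∃ e ∈ S, k < e ∧
      (st k, ticks (r₂.take k), (letters (r₂.take k)).count h) =
        (st e, ticks (r₂.take e), (letters (r₂.take e)).count h) := by
    obtain ⟨k, hk, e, he, hne, heq⟩ := Finset.exists_ne_map_eq_of_card_lt_of_maps_to
      (s := S) (t := Finset.univ ×ˢ (Finset.range (K + 1) ×ˢ Finset.range (C + 1)))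
      (f := fun k => (st k, ticks (r₂.take k), (letters (r₂.take k)).count h))
      (by simpa using hcard) (by
        intro k hk
        obtain ⟨-, d, hd, -⟩ := hS k hk
        simp only [Finset.coe_product, Set.mem_prod, Finset.mem_coe, Finset.mem_univ,
          Finset.mem_range, true_and]
        exact ⟨Nat.lt_succ_of_le (hK k d hd), Nat.lt_succ_of_le (hcount k)⟩)
    rcases lt_or_gt_of_ne hne with hlt | hlt
    · exact ⟨k, hk, e, he, hlt, heq⟩
    · exact ⟨e, he, k, hk, hlt, heq.symm⟩
  obtain ⟨hkl, d, hd, hdi⟩ := hS k hk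
  obtain ⟨hel, -⟩ := hS e he
  simp only [Prod.mk.injEq] at heq
  obtain ⟨hq, ht, hh⟩ := heq
  obtain ⟨W, hW⟩ : ∃ W, W = (r₂.take e).drop k := ⟨_, rfl⟩
  have htake : r₂.take e = r₂.take k ++ W := by
    rw [hW]
    conv_lhs => rw [← List.take_append_drop k (r₂.take e), List.take_take, min_eq_left hke.le]
  have hr : r₂ = r₂.take k ++ (W ++ r₂.drop e) := by
    rw [← List.append_assoc, ← htake, List.take_append_drop]
  have hW0 : ticks W = 0 := by
    rw [htake, ticks_append] at ht
    omega
  have hWh : h ∉ letters W := by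
    rw [htake, letters_append, List.count_append] at hh
    exact List.count_eq_zero.1 (by omega)
  have hWa : ∃ W', W = .out a d :: W' := by
    have hlt : k < (r₂.take e).length := by simp; omega
    rw [hW, List.drop_eq_getElem_cons hlt]
    rw [List.getElem?_eq_getElem hkl, Option.some.injEq] at hd
    exact ⟨_, by rw [List.getElem_take, hd]⟩
  have hp1 : A.Path q (r₂.take k) (st k) := by
    have := hst 0 k (Nat.zero_le _) hkl.le
    rwa [h0, List.drop_zero] at this
  have hp2 : A.Path (st k) W (st k) := by
    have := hst k e hke.le hel.le
    rwa [← hW, ← hq] at this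
  have hp3 : A.Path (st k) (r₂.drop e) s := by
    have := hst e r₂.length hel.le le_rfl
    rwa [List.take_length, h1, ← hq] at this
  have hmem : ∀ r, A.Path A.start r s → (oword r).map Prod.fst ∈ nestedLanguage a b h := by
    intro r hr
    rw [← hA]
    exact ⟨_, ⟨r, s, hs, hr, rfl⟩, rfl⟩
  set t := ticks r₁ + ticks (r₂.take k) with ht'
  have e1 : stamp 0 (r₁ ++ r₂) =
      stamp 0 (r₁ ++ r₂.take k) ++ (stamp t W ++ stamp t (r₂.drop e)) := by
    conv_lhs => rw [hr]
    rw [← List.append_assoc, stamp_append, stamp_append _ W, ticks_append, Nat.zero_add, hW0]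
    rfl
  have e2 : stamp 0 (r₁ ++ (r₂.take k ++ (W ++ (W ++ r₂.drop e)))) =
      stamp 0 (r₁ ++ r₂.take k) ++ (stamp t W ++ (stamp t W ++ stamp t (r₂.drop e))) := by
    rw [← List.append_assoc, stamp_append, stamp_append _ W, stamp_append _ W, ticks_append,
      Nat.zero_add, hW0]
    rfl
  have m1 := hmem _ (hr₁.append hr₂)
  have m2 := hmem _ (hr₁.append (hp1.append (hp2.append (hp2.append hp3))))
  rw [oword, e1] at m1
  rw [oword, e2] at m2
  have hdi' : countBefore h (t + d) (stamp 0 (r₁ ++ r₂)) +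
      countAt h (t + d) (stamp 0 (r₁ ++ r₂.take k)) = i := by
    rw [stamp_append 0 r₁ (r₂.take k), countAt_append, Nat.zero_add, ← Nat.add_assoc]
    exact hdi
  have hCs : ((stamp 0 (r₁ ++ r₂)).map Prod.fst).count h = C := by rw [map_fst_stamp, hC]
  -- The cycle `W` starts with the chosen `a` of block `i`; `m1` and `m2` are the words of the run
  -- and of the run with `W` repeated.
  obtain ⟨τ', hb, hτ'⟩ := exists_mem_opposite_block hab hah hbh (by rwa [map_fst_stamp]) m1 m2
    (τ := t + d) (i := i) (by obtain ⟨W', rfl⟩ := hWa; simp [stamp])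
    (by rw [← e1]; exact hdi') (by rw [← e1, hCs]; exact hi)
  rw [← e1, hCs] at hτ'
  obtain ⟨d', hd'⟩ := exists_delay_of_mem_stamp hW0 hb
  simp only at hd'
  subst hd'
  exact ⟨k, d, d', hK k d hd, hdi', hτ'⟩

theorem NestedWord.mem_right {w : List α} (hw : NestedWord a b h w) : b ∈ w := by
  cases hw <;> simp

theorem not_isUntimedADBLanguage_nestedLanguage (hab : a ≠ b) (hah : a ≠ h) (hbh : b ≠ h) :
    ¬ IsUntimedADBLanguage (nestedLanguage a b h) := by
  classical
  rintro ⟨Q, _, A, hA⟩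
  have := Fintype.ofFinite Q
  have hmem : ∀ r, ∀ q ∈ A.accept, A.Path A.start r q →
      (oword r).map Prod.fst ∈ nestedLanguage a b h := by
    intro r q hq hr
    rw [← hA]
    exact ⟨_, ⟨r, q, hq, hr, rfl⟩, rfl⟩
  obtain ⟨N, hN⟩ := exists_count_le (a := a) (b := b) (A := A) (by
    intro r q hq hr
    rw [← (oword_perm_letters r).count_eq, ← (oword_perm_letters r).count_eq]
    rcases mem_nestedLanguage_iff.1 (hmem r q hq hr) with hw | hw
    · rw [hw]; simp
    · exact hw.count_eq hab hah hbh)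
  set K := A.delays.sup id with hKdef
  have hKle : ∀ d : A.delays, (d : ℕ) ≤ K := fun d => Finset.le_sup (f := id) d.2
  -- `M` is the number of triples of a tick offset at most `K` and two delays; `M + 1` blocks exceed
  -- it. `n` leaves, after the loss of `N` letters, more than the pigeonhole bound for `C = 2 * M +
  -- 1` separators.
  set M := (K + 1) * (Fintype.card A.delays * Fintype.card A.delays) with hM
  set n := N + Fintype.card Q * ((K + 1) * (2 * M + 1 + 1)) + 1 with hn
  have hw : NestedWord a b h (nestedBlocks a b h (List.replicate (M + 1) n)) :=
    nestedWord_nestedBlocks _ (by simp) (by simp [List.mem_replicate, hn])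
  have hwA := mem_nestedLanguage_iff.2 (.inr hw)
  rw [← hA] at hwA
  obtain ⟨_, ⟨r, s, hs, hr, rfl⟩, hrw⟩ := hwA
  simp only at hrw
  have hC : (letters r).count h = 2 * M + 1 := by
    rw [← (oword_perm_letters r).count_eq, hrw, count_nestedBlocks_replicate hah hbh]
  obtain ⟨r₁, db, r₂', rfl, hbr₁⟩ := exists_first_out (b := b) (r := r)
    ((oword_perm_letters r).mem_iff.1 (by rw [hrw]; exact hw.mem_right))
  obtain ⟨r₂, hr₂def⟩ : ∃ r₂, r₂ = .out b db :: r₂' := ⟨_, rfl⟩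
  rw [← hr₂def] at hr hrw hC
  obtain ⟨q, hr₁, hr₂⟩ := hr.exists_of_append
  have hpair := hw.pairwise hab hah hbh
  rw [← hrw] at hpair
  -- The first `b`, generated at time `ticks r₁`, is output by `ticks r₁ + K`, and no `a` is output
  -- later.
  have htime : ∀ k d, r₂[k]? = some (.out a d) → ticks (r₂.take k) ≤ K := by
    intro k d hd
    obtain ⟨hk, hd⟩ := List.getElem?_eq_some_iff.1 hd
    have h1 : (a, ticks r₁ + ticks (r₂.take k) + d) ∈ stamp 0 (r₁ ++ r₂) := by
      have : r₂ = r₂.take k ++ .out a d :: r₂.drop (k + 1) := by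
        rw [← hd, ← List.drop_eq_getElem_cons hk, List.take_append_drop]
      have e : stamp 0 (r₁ ++ r₂) =
          stamp 0 (r₁ ++ (r₂.take k ++ .out a d :: r₂.drop (k + 1))) := by rw [← this]
      rw [e, stamp_append, stamp_append]
      simp [stamp]
    have h2 : (b, ticks r₁ + db) ∈ stamp 0 (r₁ ++ r₂) := by
      rw [hr₂def, stamp_append]
      simp [stamp]
    have := stamp_le_of_pairwise hpair h1 h2 hab
    have := hKle db
    omega
  have key : ∀ i : Fin (M + 1), ∃ (k : ℕ) (d d' : A.delays), ticks (r₂.take k) ≤ K ∧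
      countBefore h (ticks r₁ + ticks (r₂.take k) + d) (stamp 0 (r₁ ++ r₂)) +
        countAt h (ticks r₁ + ticks (r₂.take k) + d) (stamp 0 (r₁ ++ r₂.take k)) = i ∧
      countBefore h (ticks r₁ + ticks (r₂.take k) + d') (stamp 0 (r₁ ++ r₂)) +
        countAt h (ticks r₁ + ticks (r₂.take k) + d') (stamp 0 (r₁ ++ r₂.take k)) =
          2 * M + 1 - i := by
    intro i
    have hiM : (i : ℕ) ≤ M := Nat.lt_succ_iff.1 i.2
    refine exists_opposite_delays hab hah hbh hA hr₁ hr₂ hs htime hC (by omega) ?_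
    -- Block `i` has `n` letters, of which `r₁` generates at most `N`.
    have h1 := blockCount_nestedBlocks_replicate hab hah n hiM
    rw [← hrw, oword, blockCount_insertionSort] at h1
    conv_lhs at h1 => rw [stamp_append 0 r₁ r₂, stampBlockCount_append, Nat.zero_add]
    have h2 := stampBlockCount_le_count (h := h) (x := a) (i := i)
      (fun τ => countBefore h τ (stamp 0 r₁ ++ stamp (ticks r₁) r₂)) (stamp 0 r₁)
    have h3 := hN r₁ q r₂ s hs hr₁ hr₂
    rw [List.count_eq_zero.2 hbr₁] at h3
    rw [map_fst_stamp] at h2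
    rw [stamp_append 0 r₁ r₂, Nat.zero_add]
    omega
  choose k d d' hk hd hd' using key
  obtain ⟨i, j, hij, heq⟩ : ∃ i j, i < j ∧
      ((⟨ticks (r₂.take (k i)), Nat.lt_succ_of_le (hk i)⟩ : Fin (K + 1)), d i, d' i) =
        ((⟨ticks (r₂.take (k j)), Nat.lt_succ_of_le (hk j)⟩ : Fin (K + 1)), d j, d' j) := by
    obtain ⟨i, j, hne, heq⟩ := Fintype.exists_ne_map_eq_of_card_lt
      (fun i => ((⟨ticks (r₂.take (k i)), Nat.lt_succ_of_le (hk i)⟩ : Fin (K + 1)), d i, d' i))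
      (by simp only [Fintype.card_prod, Fintype.card_fin]; omega)
    rcases lt_or_gt_of_ne hne with hlt | hlt
    · exact ⟨i, j, hlt, heq⟩
    · exact ⟨j, i, hlt, heq.symm⟩
  simp only [Prod.mk.injEq, Fin.mk.injEq] at heq
  obtain ⟨ht, hdd, hdd'⟩ := heq
  have hmono : ∀ τ {l l'}, l ≤ l' → countAt h τ (stamp 0 (r₁ ++ r₂.take l)) ≤
      countAt h τ (stamp 0 (r₁ ++ r₂.take l')) := by
    intro τ l l' hl
    have : r₂.take l' = r₂.take l ++ (r₂.take l').drop l := by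
      conv_lhs => rw [← List.take_append_drop l (r₂.take l'), List.take_take, min_eq_left hl]
    rw [this, ← List.append_assoc, stamp_append _ (r₁ ++ r₂.take l), countAt_append]
    exact Nat.le_add_right _ _
  have hi := hd i
  have hj := hd j
  have hi' := hd' i
  have hj' := hd' j
  rw [← ht, ← hdd] at hj
  rw [← ht, ← hdd'] at hj'
  have hij' : (i : ℕ) < j := hij
  have hjM := j.2
  -- By `hmono` block indices at a fixed output time do not decrease: the first case would give `C -
  -- i ≤ C - j` for the `b`, the second `j ≤ i` for the `a`.
  rcases le_total (k i) (k j) with hkij | hkij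
  · have := hmono (ticks r₁ + ticks (r₂.take (k i)) + d' i) hkij
    omega
  · have := hmono (ticks r₁ + ticks (r₂.take (k i)) + d i) hkij
    omega

end NotADB

theorem mainTheorem3 {α : Type*} :
    -- every regular language is an untimed ADB language, over any alphabet
    {L : Language α | L.IsRegular} ⊆ {L : Language α | IsUntimedADBLanguage L} ∧
    ∀ a b c : α, a ≠ b → a ≠ c → b ≠ c →
      -- (1) the inclusion is strict
      {L : Language α | L.IsRegular} ⊂ {L : Language α | IsUntimedADBLanguage L} ∧
      -- (2) incomparability with the context-free languages
      ¬ {L : Language α | IsUntimedADBLanguage L} ⊆ {L : Language α | L.IsContextFree} ∧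
      ¬ {L : Language α | L.IsContextFree} ⊆ {L : Language α | IsUntimedADBLanguage L} ∧
      -- first witness
      IsUntimedADBLanguage (tripleLanguage a b c) ∧
      ¬ (tripleLanguage a b c).IsContextFree ∧
      -- second witness, with `c` as the separator
      IsVisiblyPushdownLanguage (nestedLanguage a b c) ∧
      (nestedLanguage a b c).IsContextFree ∧
      ¬ IsUntimedADBLanguage (nestedLanguage a b c) := by
  have hreg : {L : Language α | L.IsRegular} ⊆ {L : Language α | IsUntimedADBLanguage L} :=
    fun _ hL => hL.isUntimedADBLanguage
  refine ⟨hreg, fun a b c hab hac hbc => ?_⟩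
  have h1 := isUntimedADBLanguage_tripleLanguage a b c
  have h2 := not_isContextFree_tripleLanguage hab hac hbc
  have h3 := isContextFree_nestedLanguage a b c
  have h4 := not_isUntimedADBLanguage_nestedLanguage hab hac hbc
  exact ⟨⟨hreg, fun hsub => not_isRegular_tripleLanguage hab hac (hsub h1)⟩,
    fun hsub => h2 (hsub h1), fun hsub => h4 (hsub h3), h1, h2,
    isVisiblyPushdownLanguage_nestedLanguage hab hac hbc, h3, h4⟩
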